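/- **Lemma 4.4 (isentropic Euler satisfies the assumptions).** Let $\gamma>1$ and $C>0$. Write $u=(u_1,u_2)=(\rho,\rho v)\in\mathbb R^2$ and consider the isentropic Euler system $u_t+f(u)_x=0$ with flux and physical entropy $$f(u)=\Big(u_2,\ \frac{u_2^2}{u_1}+u_1^\gamma\Big)=(\rho v,\ \rho v^2+\rho^\gamma),\qquad \eta(u)=\frac{\rho v^2}{2}+\frac{\rho^\gamma}{\gamma-1}$$ (both equal to $0$ at the vacuum $u=(0,0)$), and with state set $$\mathcal V_0=\Big\{(\rho,\rho v):\ \rho\ge 0,\ -C<v-c_1\rho^{\frac{\gamma-1}{2}}\le v+c_1\rho^{\frac{\gamma-1}{2}}<C\Big\},\qquad c_1=\frac{2\sqrt\gamma}{\gamma-1}.$$ Let $\mathcal V$ be the interior of $\mathcal V_0$. Then $\mathcal V_0$ is bounded, $f\in C(\mathcal V_0)\cap C^4(\mathcal V)$, and $f'(u)$ has real eigenvalues $\lambda_1(u),\lambda_2(u)$ for $u\in\mathcal V$. Moreover there are a function $q$ on $\mathcal V_0$ and, for all $u_L,u_R\in\mathcal V$, numbers $s_{u_L},s_{u_R}\in(0,\infty)$,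 curves $S^1_{u_L}:[0,s_{u_L})\to\mathcal V$, $S^2_{u_R}:[0,s_{u_R})\to\mathcal V$ and functions $\sigma^1_{u_L}$ on $(0,s_{u_L})$, $\sigma^2_{u_R}$ on $(0,s_{u_R})$ such that (a)–(k) below hold. Terminology. $(u_L,u_R)$ with $u_L\ne u_R$ in $\mathcal V_0$ is an *entropic Rankine–Hugoniot discontinuity* with speed $\sigma\in\mathbb R$ if $f(u_R)-f(u_L)=\sigma(u_R-u_L)$ and $q(u_R)-q(u_L)\le\sigma(\eta(u_R)-\eta(u_L))$. For $u_L,u_R\in\mathcal V$, it is a *1-shock* if moreover $\lambda_1(u_R)<\sigma<\lambda_1(u_L)$ and $\sigma<\lambda_2(u_R)$, and a *2-shock* if moreover $\lambda_2(u_R)<\sigma<\lambda_2(u_L)$ and $\lambda_1(u_L)<\sigma$. The relative entropy is $\eta(a|b)=\eta(a)-\eta(b)-\nabla\eta(b)\cdot(a-b)$. * (a) $\lambda_1(u)<\lambda_2(u)$ for all $u\in\mathcal V$. * (b) $\lambda_i'(u)\cdot r\ne0$ for all $u\in\mathcal V$, $i=1,2$ and every eigenvector $r$ of $f'(u)$ for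 $\lambda_i(u)$. * (c) $\eta$ is strictly convex on $\mathcal V_0$ with $\eta''$ positive definite on $\mathcal V$; $\eta,q\in C(\mathcal V_0)\cap C^3(\mathcal V)$; and $q'=\eta'f'$ on $\mathcal V$. * (d) For all $b\in\mathcal V$ and every left eigenvector $\ell$ of $f'(b)$, the function $u\mapsto\ell\cdot f(u)$ is convex or concave on $\mathcal V$. * (e) There is $L>0$ with $|\lambda_i(u)|\le L$ for all $u\in\mathcal V$, $i=1,2$. * (f) For every $u_L\in\mathcal V$, $S^1_{u_L}$ is continuous, is $C^1$ on $(0,s_{u_L})$, starts at $S^1_{u_L}(0)=u_L$, leaves every compact subset of $\mathcal V$ as $s\to s_{u_L}$, and $(u_L,S^1_{u_L}(s))$ is a 1-shock with speed $\sigma^1_{u_L}(s)$ for $0<s<s_{u_L}$. The parameter is the strength of the shock, $s=|u_L-S^1_{u_L}(s)|$, in the following sense: every $d\in\mathcal V$ has an $\varepsilon>0$ such that this holds whenever $u_L\in\mathcal V$, $|u_L-d|<\varepsilon$ and $0<s<\min(\varepsilon,s_{u_L})$; and it holds for all $s\in(0,s_{u_L})$ if $\frac{d}{ds}|u_L-S^1_{u_L}(s)|>0$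 on $(0,s_{u_L})$. In the same way, for every $u_R\in\mathcal V$, $S^2_{u_R}$ is a curve from $u_R$ such that $(S^2_{u_R}(s),u_R)$ is a 2-shock with speed $\sigma^2_{u_R}(s)$ for $0<s<s_{u_R}$, with the same properties. * (g) If $(u_L,u_R)$, $u_L\in\mathcal V_0$, $u_R\in\mathcal V$, is an entropic Rankine–Hugoniot discontinuity with speed $\sigma$, then $\sigma>\lambda_1(u_R)$. * (h) If $(u_L,u_R)$, $u_L\in\mathcal V$, $u_R\in\mathcal V_0$, is an entropic Rankine–Hugoniot discontinuity with speed $\sigma\le\lambda_1(u_L)$, then $u_R=S^1_{u_L}(s)$ and $\sigma=\sigma^1_{u_L}(s)$ for some $s\in[0,s_{u_L})$ (necessarily $s>0$). * (i) If $(u_L,u_R)$, $u_L\in\mathcal V$, $u_R\in\mathcal V_0$, is an entropic Rankine–Hugoniot discontinuity with speed $\sigma$, then $\sigma<\lambda_2(u_L)$. * (j) If $(u_L,u_R)$, $u_L\in\mathcal V_0$, $u_R\in\mathcal V$, is an entropic Rankine–Hugoniot discontinuity with speed $\sigma\ge\lambda_2(u_R)$, then $u_L=S^2_{u_R}(s)$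 and $\sigma=\sigma^2_{u_R}(s)$ for some $s\in[0,s_{u_R})$ (necessarily $s>0$). * (k) For all $u_L,u_R\in\mathcal V$: $\frac{d}{ds}\eta(u_L|S^1_{u_L}(s))>0$ and $\frac{d}{ds}\sigma^1_{u_L}(s)<0$ for $0<s<s_{u_L}$, and $\frac{d}{ds}\eta(u_R|S^2_{u_R}(s))>0$ and $\frac{d}{ds}\sigma^2_{u_R}(s)>0$ for $0<s<s_{u_R}$. -/

import Mathlib

open Set Filter Topology

noncomputable section

/-- The space of conserved quantities `u = (u₁, u₂)`, with its Euclidean norm. -/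
abbrev State := EuclideanSpace ℝ (Fin 2)

namespace ConsLaw

/-- Relative entropy `η(a | b) = η(a) - η(b) - ∇η(b)(a - b)`. -/
def relEntropy (η : State → ℝ) (a b : State) : ℝ :=
  η a - η b - fderiv ℝ η b (a - b)

/-- `(uL, uR, σ)` is an entropic Rankine-Hugoniot discontinuity of `u_t + f(u)_x = 0` for the
entropy pair `(η, q)`: a genuine jump, conserving `u` and dissipating the entropy. -/
structure IsEntropicDisc (f : State → State) (η q : State → ℝ) (uL uR : State) (σ : ℝ) :
    Prop where
  jump : uL ≠ uR
  rankineHugoniot : f uR - f uL = σ • (uR - uL)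
  entropic : q uR - q uL ≤ σ * (η uR - η uL)

/-- `(uL, uR, σ)` is a 1-shock: an entropic Rankine-Hugoniot discontinuity
satisfying the Lax inequalities of the first family. -/
structure IsOneShock (f : State → State) (η q lam₁ lam₂ : State → ℝ) (uL uR : State) (σ : ℝ) :
    Prop where
  disc : IsEntropicDisc f η q uL uR σ
  lax_left : σ < lam₁ uL
  lax_right : lam₁ uR < σ
  lax_other : σ < lam₂ uR

/-- `(uL, uR, σ)` is a 2-shock: an entropic Rankine-Hugoniot discontinuity
satisfying the Lax inequalities of the second family. -/
structure IsTwoShock (f : State → State) (η q lam₁ lam₂ : State → ℝ) (uL uR : State) (σ : ℝ) :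
    Prop where
  disc : IsEntropicDisc f η q uL uR σ
  lax_left : σ < lam₂ uL
  lax_right : lam₂ uR < σ
  lax_other : lam₁ uL < σ

/-- `ℓ` is a left eigenvector of `A`. -/
def IsLeftEigenvector (A : State →L[ℝ] State) (ℓ : State →L[ℝ] ℝ) : Prop :=
  ℓ ≠ 0 ∧ ∃ μ : ℝ, ℓ ∘L A = μ • ℓ

/-- `S : [0, smax) → V` is a (parametrized) curve issued from `u` and defined globally in `V`:
it is continuous, `C¹` for `s > 0`, and it leaves every compact subset of `V` as `s → smax`. -/
structure IsGlobalCurveFrom (V : Set State) (u : State) (smax : ℝ) (S : ℝ → State) : Prop where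
  pos : 0 < smax
  start : S 0 = u
  cont : ContinuousOn S (Ico 0 smax)
  smooth : ContDiffOn ℝ 1 S (Ioo 0 smax)
  mem : ∀ s ∈ Ico 0 smax, S s ∈ V
  exits : ∀ K ⊆ V, IsCompact K → ∀ᶠ s in 𝓝[<] smax, S s ∉ K

/-- The family of curves `S u : [0, smax u) → V`, `u ∈ V`, is parametrized by the strength
`|u - S u s| = s` of the jump:
* for small jumps, locally uniformly in `u`;
* all along the curve, for each `u` such that the strength increases (with positive derivative)
  all along the curve. -/
structure IsStrengthParam (V : Set State) (smax : State → ℝ) (S : State → ℝ → State) : Prop where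
  small : ∀ d ∈ V, ∃ ε > 0, ∀ u ∈ V ∩ Metric.ball d ε, ∀ s ∈ Ioo 0 (smax u), s < ε →
    ‖u - S u s‖ = s
  whole : ∀ u ∈ V, (∀ s ∈ Ioo 0 (smax u), 0 < deriv (fun t => ‖u - S u t‖) s) →
    ∀ s ∈ Ioo 0 (smax u), ‖u - S u s‖ = s

/-- The setting and the assumptions (a)-(k) on the system `u_t + f(u)_x = 0` with state set `V₀`
(`V = interior V₀`), characteristic speeds `lam₁`, `lam₂`, entropy pair `(η, q)`, 1-shock curves
`S₁ uL : [0, s₁ uL) → V` with speeds `σ₁ uL`, and 2-shock curves `S₂ uR : [0, s₂ uR) → V` with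
speeds `σ₂ uR`. -/
structure Assumptions (V₀ : Set State) (f : State → State) (lam₁ lam₂ η q : State → ℝ)
    (s₁ : State → ℝ) (S₁ : State → ℝ → State) (σ₁ : State → ℝ → ℝ)
    (s₂ : State → ℝ) (S₂ : State → ℝ → State) (σ₂ : State → ℝ → ℝ) : Prop where
  bounded : Bornology.IsBounded V₀
  flux_cont : ContinuousOn f V₀
  flux_smooth : ContDiffOn ℝ 4 f (interior V₀)
  eigen₁ : ∀ u ∈ interior V₀, Module.End.HasEigenvalue (fderiv ℝ f u).toLinearMap (lam₁ u)
  eigen₂ : ∀ u ∈ interior V₀, Module.End.HasEigenvalue (fderiv ℝ f u).toLinearMap (lam₂ u)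
  a : ∀ u ∈ interior V₀, lam₁ u < lam₂ u
  b₁ : ∀ u ∈ interior V₀, ∀ r : State,
    Module.End.HasEigenvector (fderiv ℝ f u).toLinearMap (lam₁ u) r → fderiv ℝ lam₁ u r ≠ 0
  b₂ : ∀ u ∈ interior V₀, ∀ r : State,
    Module.End.HasEigenvector (fderiv ℝ f u).toLinearMap (lam₂ u) r → fderiv ℝ lam₂ u r ≠ 0
  c_convex : StrictConvexOn ℝ V₀ η
  c_posDef : ∀ u ∈ interior V₀, ∀ w : State, w ≠ 0 → 0 < fderiv ℝ (fderiv ℝ η) u w w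
  c_entropy_cont : ContinuousOn η V₀
  c_entropy_smooth : ContDiffOn ℝ 3 η (interior V₀)
  c_entropyFlux_cont : ContinuousOn q V₀
  c_entropyFlux_smooth : ContDiffOn ℝ 3 q (interior V₀)
  c_compat : ∀ u ∈ interior V₀, fderiv ℝ q u = fderiv ℝ η u ∘L fderiv ℝ f u
  d : ∀ b ∈ interior V₀, ∀ ℓ : State →L[ℝ] ℝ, IsLeftEigenvector (fderiv ℝ f b) ℓ →
    ConvexOn ℝ (interior V₀) (fun u => ℓ (f u)) ∨ ConcaveOn ℝ (interior V₀) (fun u => ℓ (f u))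
  e : ∃ L > 0, ∀ u ∈ interior V₀, |lam₁ u| ≤ L ∧ |lam₂ u| ≤ L
  f_curve₁ : ∀ uL ∈ interior V₀, IsGlobalCurveFrom (interior V₀) uL (s₁ uL) (S₁ uL)
  f_shock₁ : ∀ uL ∈ interior V₀, ∀ s ∈ Ioo 0 (s₁ uL),
    IsOneShock f η q lam₁ lam₂ uL (S₁ uL s) (σ₁ uL s)
  f_param₁ : IsStrengthParam (interior V₀) s₁ S₁
  f_curve₂ : ∀ uR ∈ interior V₀, IsGlobalCurveFrom (interior V₀) uR (s₂ uR) (S₂ uR)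
  f_shock₂ : ∀ uR ∈ interior V₀, ∀ s ∈ Ioo 0 (s₂ uR),
    IsTwoShock f η q lam₁ lam₂ (S₂ uR s) uR (σ₂ uR s)
  f_param₂ : IsStrengthParam (interior V₀) s₂ S₂
  g : ∀ uL ∈ V₀, ∀ uR ∈ interior V₀, ∀ σ : ℝ, IsEntropicDisc f η q uL uR σ → lam₁ uR < σ
  h : ∀ uL ∈ interior V₀, ∀ uR ∈ V₀, ∀ σ : ℝ, IsEntropicDisc f η q uL uR σ → σ ≤ lam₁ uL →
    ∃ s ∈ Ico 0 (s₁ uL), S₁ uL s = uR ∧ σ = σ₁ uL s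
  i : ∀ uL ∈ interior V₀, ∀ uR ∈ V₀, ∀ σ : ℝ, IsEntropicDisc f η q uL uR σ → σ < lam₂ uL
  j : ∀ uL ∈ V₀, ∀ uR ∈ interior V₀, ∀ σ : ℝ, IsEntropicDisc f η q uL uR σ → lam₂ uR ≤ σ →
    ∃ s ∈ Ico 0 (s₂ uR), S₂ uR s = uL ∧ σ = σ₂ uR s
  k_strength₁ : ∀ uL ∈ interior V₀, ∀ s ∈ Ioo 0 (s₁ uL),
    0 < deriv (fun t => relEntropy η uL (S₁ uL t)) s
  k_strength₂ : ∀ uR ∈ interior V₀, ∀ s ∈ Ioo 0 (s₂ uR),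
    0 < deriv (fun t => relEntropy η uR (S₂ uR t)) s
  k_speed₁ : ∀ uL ∈ interior V₀, ∀ s ∈ Ioo 0 (s₁ uL), deriv (σ₁ uL) s < 0
  k_speed₂ : ∀ uR ∈ interior V₀, ∀ s ∈ Ioo 0 (s₂ uR), 0 < deriv (σ₂ uR) s

end ConsLaw

namespace Euler

/-- Flux of the isentropic Euler system in `u = (ρ, m)`, `m = ρ v`: `(m, m² / ρ + ρ ^ γ)`
(equal to `0` at the vacuum `u = 0`). -/
def flux (γ : ℝ) (u : State) : State := !₂[u 1, u 1 ^ 2 / u 0 + u 0 ^ γ]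

/-- The physical entropy `ρ v² / 2 + ρ ^ γ / (γ - 1)` (equal to `0` at the vacuum `u = 0`). -/
def entropy (γ : ℝ) (u : State) : ℝ := u 1 ^ 2 / (2 * u 0) + u 0 ^ γ / (γ - 1)

/-- The Riemann invariant `w₁ = v - c₁ ρ ^ ((γ - 1) / 2)`, `c₁ = 2 √γ / (γ - 1)`. -/
def w₁ (γ ρ v : ℝ) : ℝ := v - 2 * √γ / (γ - 1) * ρ ^ ((γ - 1) / 2)

/-- The Riemann invariant `w₂ = v + c₁ ρ ^ ((γ - 1) / 2)`, `c₁ = 2 √γ / (γ - 1)`. -/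
def w₂ (γ ρ v : ℝ) : ℝ := v + 2 * √γ / (γ - 1) * ρ ^ ((γ - 1) / 2)

/-- The invariant region: all `u = (ρ, ρ v)` with `ρ ≥ 0` and `-C < w₁ ≤ w₂ < C`. -/
def stateSet (γ C : ℝ) : Set State :=
  {u | ∃ ρ v : ℝ, 0 ≤ ρ ∧ u = !₂[ρ, ρ * v] ∧
    -C < w₁ γ ρ v ∧ w₁ γ ρ v ≤ w₂ γ ρ v ∧ w₂ γ ρ v < C}

end Euler

end

/-! Every jump condition reduces to inequalities in the two densities. For a jump of speed `σ`
between positive densities `a` and `ρ`, put `s = v_L - σ`. The Rankine-Hugoniot relations amount to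
the mass balance together with `s² = massFluxSq γ a ρ`, and the entropy production equals `a * s *
dissipation γ a ρ` (`entropy_balance`). Since `dissipation` has the sign opposite to that of `ρ -
a`, the jump is entropic exactly when `s * (ρ - a) > 0`; this is `isEntropicDisc_iff`. A jump to the
vacuum is impossible (`flux_ne_smul`).

Strict convexity of the pressure gives `p'(a) < massFluxSq γ a ρ` and `massFluxSq γ ρ a < p'(ρ)` for
`a < ρ`. These two bounds give the Lax inequalities and (g). For (h), `σ ≤ λ₁(u_L)` forces `s > 0`,
hence `ρ > a`, so the state lies on `shockCurve`, the 1-shock curve parametrized by the density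
jump. Along that curve `w₁` strictly decreases and `w₂` does not increase
(`monotoneOn_velocityJump_sub`, by an AM-GM inequality). The curve therefore leaves the region when
`w₁` reaches `-C` and never returns (`exists_exit`), so no shock in the state set is missed. The
speed decreases because `massFluxSq` increases, and the relative entropy has an explicitly positive
derivative in the density.

The strength need not be monotone along a whole curve. It is increasing for small jumps, locally
uniformly in the starting state; `exists_strengthParam` uses it as parameter there and continues by
an affine function of the density jump. All monotonicity statements survive an increasing change of
parameter.

The second family comes from the reflection `v ↦ -v`, which exchanges left and right and reverses
speeds. Properties (a)-(e) are direct computations. Convexity of the state set appears after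
multiplying its constraints by the density, and (d) holds because one flux component is linear and
the other is convex. -/

namespace ConsLaw

/-! ### Parametrization of curves by strength -/

/-- `Q` is an increasing `C¹` change of parameter from `(0, smax)` onto `(0, T)`, continuous up to
the end points. -/
structure IsReparam (T smax : ℝ) (Q : ℝ → ℝ) : Prop where
  pos : 0 < smax
  zero : Q 0 = 0
  right : Q smax = T
  cont : ContinuousOn Q (Icc 0 smax)
  smooth : ContDiffOn ℝ 1 Q (Ioo 0 smax)
  mem : ∀ s ∈ Ioo 0 smax, Q s ∈ Ioo 0 T
  surj : ∀ t ∈ Ioo 0 T, ∃ s ∈ Ioo 0 smax, Q s = t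
  deriv_pos : ∀ s ∈ Ioo 0 smax, ∃ c > 0, HasDerivAt Q c s

/-- A continuous function with positive continuous derivative is inverted by a change of
parameter. -/
theorem exists_isReparam_inverse {P P' : ℝ → ℝ} {T : ℝ} (hT : 0 < T) (hP0 : P 0 = 0)
    (hc : ContinuousOn P (Icc 0 T)) (hd : ∀ t ∈ Ioo 0 T, HasDerivAt P (P' t) t)
    (hpos : ∀ t ∈ Ioo 0 T, 0 < P' t) (hP' : ContinuousOn P' (Ioo 0 T)) :
    ∃ Q, IsReparam T (P T) Q ∧ ∀ s ∈ Ioo 0 (P T), P (Q s) = s := by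
  have hmono : StrictMonoOn P (Icc 0 T) := by
    refine strictMonoOn_of_deriv_pos (convex_Icc _ _) hc fun t ht => ?_
    rw [interior_Icc] at ht
    rw [(hd t ht).deriv]
    exact hpos t ht
  have h0m : (0 : ℝ) ∈ Icc 0 T := ⟨le_rfl, hT.le⟩
  have hTm : T ∈ Icc 0 T := ⟨hT.le, le_rfl⟩
  have himg : P '' Icc 0 T = Icc 0 (P T) := by
    apply Subset.antisymm
    · rintro _ ⟨t, ht, rfl⟩
      exact ⟨hP0 ▸ hmono.monotoneOn h0m ht ht.1, hmono.monotoneOn ht hTm ht.2⟩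
    · have := intermediate_value_Icc hT.le hc
      rwa [hP0] at this
  have hPT : 0 < P T := by simpa [hP0] using hmono h0m hTm hT
  set Q := Function.invFunOn P (Icc 0 T) with hQ
  have hQmem : ∀ s ∈ Icc 0 (P T), Q s ∈ Icc 0 T := fun s hs =>
    Function.invFunOn_mem (by rw [← himg] at hs; exact hs)
  have hPQ : ∀ s ∈ Icc 0 (P T), P (Q s) = s := fun s hs =>
    Function.invFunOn_eq (by rw [← himg] at hs; exact hs)
  have hQP : ∀ t ∈ Icc 0 T, Q (P t) = t := fun t ht =>
    hmono.injOn (hQmem _ (himg ▸ mem_image_of_mem P ht)) ht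
      (hPQ _ (himg ▸ mem_image_of_mem P ht))
  have hQ0 : Q 0 = 0 := by simpa [hP0] using hQP 0 h0m
  have hQT : Q (P T) = T := hQP T hTm
  have hQmono : StrictMonoOn Q (Icc 0 (P T)) := by
    intro a ha b hb hab
    by_contra! h
    have := hmono.monotoneOn (hQmem b hb) (hQmem a ha) h
    rw [hPQ a ha, hPQ b hb] at this
    linarith
  have hQimg : Q '' Icc 0 (P T) = Icc 0 T := by
    apply Subset.antisymm
    · rintro _ ⟨s, hs, rfl⟩
      exact hQmem s hs
    · intro t ht
      exact ⟨P t, himg ▸ mem_image_of_mem P ht, hQP t ht⟩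
  have hQc : ContinuousOn Q (Icc 0 (P T)) := by
    have : OrdConnected (Q '' Icc 0 (P T)) := hQimg ▸ ordConnected_Icc
    have h2 := (hQmono.orderIso Q _).continuous
    rw [continuousOn_iff_continuous_domRestrict]
    exact continuous_subtype_val.comp h2
  have hQIoo : ∀ s ∈ Ioo 0 (P T), Q s ∈ Ioo 0 T := by
    intro s hs
    have h0 := hQmono ⟨le_rfl, hPT.le⟩ (Ioo_subset_Icc_self hs) hs.1
    have h1 := hQmono (Ioo_subset_Icc_self hs) ⟨hPT.le, le_rfl⟩ hs.2
    rw [hQ0] at h0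
    rw [hQT] at h1
    exact ⟨h0, h1⟩
  have hQd : ∀ s ∈ Ioo 0 (P T), HasDerivAt Q (P' (Q s))⁻¹ s := by
    intro s hs
    refine HasDerivAt.of_local_left_inverse (hQc.continuousAt (Icc_mem_nhds hs.1 hs.2))
      (hd _ (hQIoo s hs)) (hpos _ (hQIoo s hs)).ne' ?_
    filter_upwards [Ioo_mem_nhds hs.1 hs.2] with y hy
    exact hPQ y (Ioo_subset_Icc_self hy)
  refine ⟨Q, ⟨hPT, hQ0, hQT, hQc, ?_, hQIoo, ?_, ?_⟩, fun s hs => hPQ s (Ioo_subset_Icc_self hs)⟩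
  · rw [show (1 : WithTop ℕ∞) = 0 + 1 by simp, contDiffOn_succ_iff_deriv_of_isOpen isOpen_Ioo]
    refine ⟨fun s hs => (hQd s hs).differentiableAt.differentiableWithinAt, by simp, ?_⟩
    rw [contDiffOn_zero]
    have : ContinuousOn (fun s => (P' (Q s))⁻¹) (Ioo 0 (P T)) :=
      (hP'.comp (hQc.mono Ioo_subset_Icc_self) hQIoo).inv₀
        fun s hs => (hpos _ (hQIoo s hs)).ne'
    exact this.congr fun s hs => (hQd s hs).deriv
  · intro t ht
    refine ⟨P t, ⟨?_, ?_⟩, hQP t (Ioo_subset_Icc_self ht)⟩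
    · simpa [hP0] using hmono h0m (Ioo_subset_Icc_self ht) ht.1
    · exact hmono (Ioo_subset_Icc_self ht) hTm ht.2
  · exact fun s hs => ⟨_, inv_pos.2 (hpos _ (hQIoo s hs)), hQd s hs⟩

/-- Change of parameter to `g`, as long as the old parameter is at most `r`. -/
theorem exists_isReparam_of_le {g : ℝ → ℝ} {T r : ℝ} (hT : 0 < T) (hr : 0 < r) (hg0 : g 0 = 0)
    (hc : ContinuousOn g (Icc 0 T)) (hg : ContDiffOn ℝ 1 g (Ioo 0 T))
    (hpos : ∀ t ∈ Ioo 0 T, t ≤ r → 0 < deriv g t) :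
    ∃ smax Q, IsReparam T smax Q ∧
      ∀ s ∈ Ioo 0 smax, (Q s ≤ r → g (Q s) = s) ∧ (r < Q s → g r < s) := by
  -- Beyond `r` the function `g` is replaced by its tangent line at `r`. The result is `C¹` with
  -- derivative `deriv g (min t r)`, which is positive on all of `(0, T)`.
  set P : ℝ → ℝ := fun t => g (min t r) + deriv g r * max (t - r) 0 with hP
  have hle : ∀ t, t ≤ r → P t = g t := fun t ht => by
    simp [hP, min_eq_left ht, max_eq_right (sub_nonpos.2 ht)]
  have hge : ∀ t, r ≤ t → P t = g r + deriv g r * (t - r) := fun t ht => by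
    simp [hP, min_eq_right ht, max_eq_left (sub_nonneg.2 ht)]
  have hmem : ∀ t ∈ Ioo 0 T, min t r ∈ Ioo 0 T := fun t ht =>
    ⟨lt_min ht.1 hr, (min_le_left _ _).trans_lt ht.2⟩
  have hgd : ∀ t ∈ Ioo 0 T, HasDerivAt g (deriv g t) t := fun t ht =>
    ((hg.differentiableOn one_ne_zero t ht).differentiableAt (isOpen_Ioo.mem_nhds ht)).hasDerivAt
  have hg'c : ContinuousOn (deriv g) (Ioo 0 T) :=
    hg.continuousOn_deriv_of_isOpen isOpen_Ioo le_rfl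
  have hd : ∀ t ∈ Ioo 0 T, HasDerivAt P (deriv g (min t r)) t := by
    intro t ht
    have haff : HasDerivAt (fun t => g r + deriv g r * (t - r)) (deriv g r) t := by
      simpa using (((hasDerivAt_id t).sub_const r).const_mul (deriv g r)).const_add (g r)
    rcases lt_trichotomy t r with h | h | h
    · rw [min_eq_left h.le]
      refine (hgd t ht).congr_of_eventuallyEq ?_
      filter_upwards [Iio_mem_nhds h] with y hy using hle y (le_of_lt hy)
    · subst h
      rw [min_self]
      have h1 : HasDerivWithinAt P (deriv g t) (Iic t) t :=
        (hgd t ht).hasDerivWithinAt.congr (fun y hy => hle y hy) (hle t le_rfl)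
      have h2 : HasDerivWithinAt P (deriv g t) (Ici t) t :=
        haff.hasDerivWithinAt.congr (fun y hy => hge y hy) (hge t le_rfl)
      have := h1.union h2
      rwa [Iic_union_Ici, hasDerivWithinAt_univ] at this
    · rw [min_eq_right h.le]
      refine haff.congr_of_eventuallyEq ?_
      filter_upwards [Ioi_mem_nhds h] with y hy using hge y (le_of_lt hy)
  have hPc : ContinuousOn P (Icc 0 T) := by
    refine ContinuousOn.add (hc.comp (by fun_prop) fun t ht => ?_) (by fun_prop)
    exact ⟨le_min ht.1 hr.le, (min_le_left _ _).trans ht.2⟩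
  obtain ⟨Q, hQ, hPQ⟩ := exists_isReparam_inverse hT ((hle 0 hr.le).trans hg0) hPc hd
    (fun t ht => hpos _ (hmem t ht) (min_le_right _ _))
    (hg'c.comp (by fun_prop) hmem)
  refine ⟨P T, Q, hQ, fun s hs => ⟨fun h => ?_, fun h => ?_⟩⟩
  · rw [← hle _ h, hPQ s hs]
  · have h1 := hPQ s hs
    rw [hge _ h.le] at h1
    have h2 := hpos r ⟨hr, h.trans (hQ.mem s hs).2⟩ le_rfl
    have := mul_pos h2 (sub_pos.2 h)
    linarith

/-- A family of curves along which the strength increases at first, locally uniformly in the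
starting point, has a parametrization by strength. -/
theorem exists_strengthParam {V : Set State} {T : State → ℝ} {U : State → ℝ → State}
    (hT : ∀ u ∈ V, 0 < T u) (hU0 : ∀ u ∈ V, U u 0 = u)
    (hUc : ∀ u ∈ V, ContinuousOn (U u) (Icc 0 (T u)))
    (hU1 : ∀ u ∈ V, ContDiffOn ℝ 1 (U u) (Ioo 0 (T u)))
    (hge : ∀ u ∈ V, ∀ t ∈ Ioo 0 (T u), t ≤ ‖u - U u t‖)
    (hpos : ∀ d ∈ V, ∃ ε > 0, ∀ u ∈ V ∩ Metric.ball d ε, ∀ t ∈ Ioo 0 (T u), t < ε →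
      0 < deriv (fun t => ‖u - U u t‖) t) :
    ∃ (smax : State → ℝ) (Q : State → ℝ → ℝ),
      IsStrengthParam V smax (fun u s => U u (Q u s)) ∧
      ∀ u ∈ V, IsReparam (T u) (smax u) (Q u) := by
  classical
  set g : State → ℝ → ℝ := fun u t => ‖u - U u t‖ with hg
  set B : State → Set ℝ := fun u => {t | t ∈ Ioo 0 (T u) ∧ deriv (g u) t ≤ 0} with hB
  -- Half of the infimum keeps `r u` strictly below every bad parameter. Without bad parameters `r u
  -- = T u`, and the strength is the parameter all along the curve.
  set r : State → ℝ := fun u => if (B u).Nonempty then sInf (B u) / 2 else T u with hrdef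
  have hBbdd : ∀ u, BddBelow (B u) := fun u => ⟨0, fun t ht => ht.1.1.le⟩
  have hlow : ∀ d ∈ V, ∃ ε > 0, ∀ u ∈ V ∩ Metric.ball d ε, (B u).Nonempty → ε ≤ r u := by
    intro d hd
    obtain ⟨ε, hε, h⟩ := hpos d hd
    refine ⟨ε / 2, by positivity, fun u hu hne => ?_⟩
    have hu' : u ∈ V ∩ Metric.ball d ε := ⟨hu.1, Metric.ball_subset_ball (by linarith) hu.2⟩
    have : ε ≤ sInf (B u) := by
      refine le_csInf hne fun t ht => ?_
      by_contra! hlt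
      exact absurd (h u hu' t ht.1 hlt) (not_lt.2 ht.2)
    simp only [hrdef, if_pos hne]
    linarith
  have hrpos : ∀ u ∈ V, 0 < r u := by
    intro u hu
    by_cases hne : (B u).Nonempty
    · obtain ⟨ε, hε, h⟩ := hlow u hu
      exact hε.trans_le (h u ⟨hu, Metric.mem_ball_self hε⟩ hne)
    · simpa only [hrdef, if_neg hne] using hT u hu
  have hgpos : ∀ u ∈ V, ∀ t ∈ Ioo 0 (T u), t ≤ r u → 0 < deriv (g u) t := by
    intro u hu t ht htr
    by_contra! hle
    have htB : t ∈ B u := ⟨ht, hle⟩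
    have hne : (B u).Nonempty := ⟨t, htB⟩
    have h1 : r u = sInf (B u) / 2 := by simp only [hrdef, if_pos hne]
    have h2 := csInf_le (hBbdd u) htB
    have h3 := hrpos u hu
    linarith
  have hgc : ∀ u ∈ V, ContinuousOn (g u) (Icc 0 (T u)) := fun u hu =>
    (continuousOn_const.sub (hUc u hu)).norm
  have hg1 : ∀ u ∈ V, ContDiffOn ℝ 1 (g u) (Ioo 0 (T u)) := fun u hu =>
    (contDiffOn_const.sub (hU1 u hu)).norm ℝ fun t ht h => by
      have := hge u hu t ht
      rw [h, norm_zero] at this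
      exact absurd ht.1 (not_lt.2 this)
  have hex : ∀ u, ∃ smax Q, u ∈ V → IsReparam (T u) smax Q ∧
      ∀ s ∈ Ioo 0 smax, (Q s ≤ r u → g u (Q s) = s) ∧ (r u < Q s → g u (r u) < s) := by
    intro u
    by_cases hu : u ∈ V
    · obtain ⟨smax, Q, h⟩ := exists_isReparam_of_le (hT u hu) (hrpos u hu)
        (by simp [hg, hU0 u hu]) (hgc u hu) (hg1 u hu) (hgpos u hu)
      exact ⟨smax, Q, fun _ => h⟩
    · exact ⟨0, id, fun h => absurd h hu⟩
  choose smax Q hQ using hex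
  refine ⟨smax, Q, ⟨fun d hd => ?_, fun u hu hder s hs => ?_⟩, fun u hu => (hQ u hu).1⟩
  · obtain ⟨ε, hε, h⟩ := hlow d hd
    refine ⟨ε, hε, fun u hu s hs hsε => ?_⟩
    obtain ⟨hR, hgs⟩ := hQ u hu.1
    rcases le_or_gt (Q u s) (r u) with hle | hlt
    · exact (hgs s hs).1 hle
    -- Past `r u` the new parameter exceeds the strength at `r u`, which is at least `r u ≥ ε`.
    · exfalso
      have hQs := hR.mem s hs
      by_cases hne : (B u).Nonempty
      · have h1 := (hgs s hs).2 hlt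
        have h2 := h u hu hne
        have h3 := hge u hu.1 (r u) ⟨hrpos u hu.1, hlt.trans hQs.2⟩
        simp only [hg] at h1
        linarith
      · simp only [hrdef, if_neg hne] at hlt
        linarith [hQs.2]
  · obtain ⟨hR, hgs⟩ := hQ u hu
    -- The hypothesis concerns the new parameter; since `Q` has positive derivative, the chain rule
    -- carries the sign back to the old one.
    have hne : ¬ (B u).Nonempty := by
      rintro ⟨t, ht, htle⟩
      obtain ⟨s₀, hs₀, rfl⟩ := hR.surj t ht
      obtain ⟨c, hc, hcd⟩ := hR.deriv_pos s₀ hs₀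
      have h1 : HasDerivAt (g u) (deriv (g u) (Q u s₀)) (Q u s₀) :=
        (((hg1 u hu).differentiableOn one_ne_zero _ ht).differentiableAt
          (isOpen_Ioo.mem_nhds ht)).hasDerivAt
      have h2 := (h1.comp s₀ hcd).deriv
      have h3 := hder s₀ hs₀
      have h4 : (fun t => ‖u - U u (Q u t)‖) = g u ∘ Q u := rfl
      rw [h4, h2] at h3
      nlinarith
    refine (hgs s hs).1 ?_
    simp only [hrdef, if_neg hne]
    exact (hR.mem s hs).2.le

end ConsLaw

/-! ### The state set and its vacuum point -/

namespace Euler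

variable {γ C : ℝ}

/-- The part of the state set away from the vacuum. -/
def region (γ C : ℝ) : Set State :=
  {u | 0 < u 0 ∧ -C < w₁ γ (u 0) (u 1 / u 0) ∧ w₂ γ (u 0) (u 1 / u 0) < C}

/-- The characteristic speeds `v ± √(p'(ρ))`: `ε = -1` for the first family, `ε = 1` for the
second. -/
noncomputable def charSpeed (γ ε : ℝ) (u : State) : ℝ :=
  u 1 / u 0 + ε * (√γ * u 0 ^ ((γ - 1) / 2))

/-- The entropy flux `v (ρ v² / 2 + γ ρ ^ γ / (γ - 1))`. -/
noncomputable def entropyFlux (γ : ℝ) (u : State) : ℝ :=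
  u 1 ^ 3 / (2 * u 0 ^ 2) + γ / (γ - 1) * (u 1 * u 0 ^ (γ - 1))

theorem state_ext {x y : State} (h0 : x 0 = y 0) (h1 : x 1 = y 1) : x = y := by
  ext i
  fin_cases i
  · exact h0
  · exact h1

theorem riemannCoeff_pos (hγ : 1 < γ) : 0 < 2 * √γ / (γ - 1) := by
  have h1 : 0 < √γ := Real.sqrt_pos.2 (by linarith)
  have h2 : 0 < γ - 1 := by linarith
  positivity

/-- At zero density the momentum `ρ v` vanishes whatever `v` is, so the vacuum contributes a single
point. -/
theorem stateSet_eq (hγ : 1 < γ) (hC : 0 < C) : stateSet γ C = insert 0 (region γ C) := by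
  ext u
  simp only [stateSet, region, mem_ofPred_eq, mem_insert_iff]
  constructor
  · rintro ⟨ρ, v, hρ, rfl, h1, h2, h3⟩
    rcases hρ.eq_or_lt with rfl | hρ
    · left
      apply state_ext <;> simp
    · right
      have hv : ρ * v / ρ = v := by field_simp
      simpa [hv] using ⟨hρ, h1, h3⟩
  · rintro (rfl | ⟨h0, h1, h2⟩)
    · refine ⟨0, 0, le_rfl, by apply state_ext <;> simp, ?_⟩
      have : (γ - 1) / 2 ≠ 0 := by linarith
      simp [w₁, w₂, Real.zero_rpow this, hC]
    · refine ⟨u 0, u 1 / u 0, h0.le, ?_, h1, ?_, h2⟩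
      · apply state_ext <;> simp
        field_simp
      · have := riemannCoeff_pos hγ
        have h3 := Real.rpow_pos_of_pos h0 ((γ - 1) / 2)
        have := mul_pos this h3
        simp only [w₁, w₂]
        linarith

theorem isOpen_region (γ C : ℝ) : IsOpen (region γ C) := by
  rw [isOpen_iff_mem_nhds]
  rintro u ⟨h0, h1, h2⟩
  have hc0 : ContinuousAt (fun u : State => u 0) u := by fun_prop
  have hc : ContinuousAt (fun u : State => u 1 / u 0) u :=
    ContinuousAt.div (by fun_prop) hc0 h0.ne'
  have hr : ContinuousAt (fun u : State => u 0 ^ ((γ - 1) / 2)) u :=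
    hc0.rpow_const (Or.inl h0.ne')
  filter_upwards [hc0.eventually_const_lt h0,
    (hc.sub (continuousAt_const.mul hr)).eventually_const_lt h1,
    (hc.add (continuousAt_const.mul hr)).eventually_lt_const h2] with y a b c
  exact ⟨a, b, c⟩

theorem region_subset (hγ : 1 < γ) (hC : 0 < C) : region γ C ⊆ stateSet γ C := by
  rw [stateSet_eq hγ hC]
  exact subset_insert _ _

/-- The vacuum is not interior: states of negative density accumulate at it. -/
theorem interior_stateSet (hγ : 1 < γ) (hC : 0 < C) : interior (stateSet γ C) = region γ C := by
  apply Subset.antisymm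
  · intro u hu
    have hmem := interior_subset hu
    rw [stateSet_eq hγ hC] at hmem
    rcases hmem with rfl | h
    · exfalso
      have hcont : Continuous fun t : ℝ => (!₂[t, 0] : State) := by fun_prop
      have h0 : (!₂[(0 : ℝ), 0] : State) = 0 := by apply state_ext <;> simp
      have hev : ∀ᶠ t in 𝓝 (0 : ℝ), (!₂[t, 0] : State) ∈ stateSet γ C :=
        hcont.continuousAt.eventually_mem
          (by rw [h0]; exact mem_interior_iff_mem_nhds.1 hu)
      obtain ⟨t, ht, ht'⟩ := ((hev.filter_mono nhdsWithin_le_nhds).and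
        (self_mem_nhdsWithin : ∀ᶠ t in 𝓝[<] (0 : ℝ), t ∈ Iio 0)).exists
      obtain ⟨ρ, v, hρ, he, -⟩ := ht
      have := congrArg (fun x : State => x 0) he
      simp at this
      rw [this] at ht'
      exact absurd ht' (not_lt.2 hρ)
    · exact h
  · exact interior_maximal (region_subset hγ hC) (isOpen_region γ C)

/-- On the state set `|v| ≤ C` and `c₁ ρ ^ ((γ - 1) / 2) ≤ C`. -/
theorem exists_velocity (hγ : 1 < γ) {u : State} (hu : u ∈ stateSet γ C) :
    ∃ ρ v : ℝ, 0 ≤ ρ ∧ u = !₂[ρ, ρ * v] ∧ |v| < C ∧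
      2 * √γ / (γ - 1) * ρ ^ ((γ - 1) / 2) < C := by
  obtain ⟨ρ, v, hρ, hu, h1, h2, h3⟩ := hu
  have hp := mul_nonneg (riemannCoeff_pos hγ).le (Real.rpow_nonneg hρ ((γ - 1) / 2))
  simp only [w₁, w₂] at h1 h2 h3
  exact ⟨ρ, v, hρ, hu, abs_lt.2 ⟨by linarith, by linarith⟩, by linarith⟩

theorem sound_sq {ρ : ℝ} (hρ : 0 ≤ ρ) (γ : ℝ) : (ρ ^ ((γ - 1) / 2)) ^ 2 = ρ ^ (γ - 1) := by
  rw [← Real.rpow_natCast, ← Real.rpow_mul hρ]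
  norm_num

theorem pressure_eq {ρ : ℝ} (hρ : 0 < ρ) (γ : ℝ) : ρ ^ γ = ρ * ρ ^ (γ - 1) := by
  rw [Real.rpow_sub_one hρ.ne']
  field_simp

theorem exists_density_bound (hγ : 1 < γ) (hC : 0 < C) :
    ∃ M > 0, ∀ ρ : ℝ, 0 ≤ ρ → 2 * √γ / (γ - 1) * ρ ^ ((γ - 1) / 2) < C → ρ ≤ M := by
  have hc := riemannCoeff_pos hγ
  have hθ : 0 < (γ - 1) / 2 := by linarith
  refine ⟨(C / (2 * √γ / (γ - 1))) ^ ((γ - 1) / 2)⁻¹, by positivity, fun ρ hρ h => ?_⟩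
  rw [mul_comm, ← lt_div_iff₀ hc] at h
  calc ρ = (ρ ^ ((γ - 1) / 2)) ^ ((γ - 1) / 2)⁻¹ := (Real.rpow_rpow_inv hρ hθ.ne').symm
    _ ≤ _ := Real.rpow_le_rpow (Real.rpow_nonneg hρ _) h.le (by positivity)

theorem isBounded_stateSet (hγ : 1 < γ) (hC : 0 < C) : Bornology.IsBounded (stateSet γ C) := by
  obtain ⟨M, hM, hb⟩ := exists_density_bound hγ hC
  rw [isBounded_iff_forall_norm_le]
  refine ⟨M * (1 + C), fun u hu => ?_⟩
  obtain ⟨ρ, v, hρ, rfl, hv, hr⟩ := exists_velocity hγ hu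
  have hρM := hb ρ hρ hr
  rw [EuclideanSpace.norm_eq]
  apply Real.sqrt_le_iff.2 ⟨by positivity, ?_⟩
  simp only [Fin.sum_univ_two, Real.norm_eq_abs, sq_abs]
  simp only [Matrix.cons_val_zero, Matrix.cons_val_one, mul_pow]
  have h1 : ρ ^ 2 ≤ M ^ 2 := by gcongr
  have h2 : v ^ 2 ≤ C ^ 2 := sq_le_sq' (by linarith [(abs_lt.1 hv).1]) (abs_lt.1 hv).2.le
  have h3 : ρ ^ 2 * v ^ 2 ≤ M ^ 2 * C ^ 2 := by gcongr
  nlinarith [mul_pos (pow_pos hM 2) hC]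

/-- A function which is continuous away from the vacuum and `O(ρ)` is continuous on the state
set. -/
theorem continuousOn_stateSet (hγ : 1 < γ) (hC : 0 < C) {g : State → ℝ} (K : ℝ)
    (hg : ∀ u ∈ region γ C, ContinuousAt g u) (hK : ∀ u ∈ stateSet γ C, |g u| ≤ K * u 0) :
    ContinuousOn g (stateSet γ C) := by
  intro u hu
  have hu' := hu
  rw [stateSet_eq hγ hC] at hu'
  rcases hu' with rfl | h
  · have h0 : g 0 = 0 := by simpa using hK 0 hu
    rw [ContinuousWithinAt, h0]
    refine squeeze_zero_norm' (a := fun u : State => K * u 0) ?_ ?_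
    · filter_upwards [self_mem_nhdsWithin] with y hy using hK y hy
    · have : ContinuousAt (fun u : State => K * u 0) 0 := by fun_prop
      simpa [ContinuousAt] using this.tendsto.mono_left nhdsWithin_le_nhds
  · exact (hg u h).continuousWithinAt

/-! ### Regularity away from the vacuum -/

theorem contDiffAt_density_rpow {n : WithTop ℕ∞} (p : ℝ) {u : State} (hu : 0 < u 0) :
    ContDiffAt ℝ n (fun u : State => u 0 ^ p) u :=
  have h : ContDiffAt ℝ n (fun u : State => u 0) u := by fun_prop
  h.rpow_const_of_ne hu.ne'

theorem contDiffAt_flux {n : WithTop ℕ∞} (γ : ℝ) {u : State} (hu : 0 < u 0) :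
    ContDiffAt ℝ n (flux γ) u := by
  refine contDiffAt_euclidean.2 fun i => ?_
  fin_cases i
  · change ContDiffAt ℝ n (fun u : State => u 1) u
    fun_prop
  · change ContDiffAt ℝ n (fun u : State => u 1 ^ 2 / u 0 + u 0 ^ γ) u
    have h : ContDiffAt ℝ n (fun u : State => u 1 ^ 2 / u 0) u :=
      ContDiffAt.div (by fun_prop) (by fun_prop) hu.ne'
    exact h.add (contDiffAt_density_rpow γ hu)

theorem contDiffAt_entropy {n : WithTop ℕ∞} (γ : ℝ) {u : State} (hu : 0 < u 0) :
    ContDiffAt ℝ n (entropy γ) u :=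
  (ContDiffAt.div (by fun_prop) (by fun_prop) (by positivity)).add
    ((contDiffAt_density_rpow γ hu).div_const _)

theorem contDiffAt_entropyFlux {n : WithTop ℕ∞} (γ : ℝ) {u : State} (hu : 0 < u 0) :
    ContDiffAt ℝ n (entropyFlux γ) u :=
  (ContDiffAt.div (by fun_prop) (by fun_prop) (by positivity)).add
    (contDiffAt_const.mul (ContDiffAt.mul (by fun_prop) (contDiffAt_density_rpow _ hu)))

theorem exists_pressure_bound (hγ : 1 < γ) (hC : 0 < C) :
    ∃ M > 0, ∀ u ∈ stateSet γ C, u 0 ^ γ ≤ M * u 0 := by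
  obtain ⟨M, hM, hb⟩ := exists_density_bound hγ hC
  refine ⟨M ^ (γ - 1), by positivity, fun u hu => ?_⟩
  obtain ⟨ρ, v, hρ, rfl, hv, hr⟩ := exists_velocity hγ hu
  simp only [Matrix.cons_val_zero]
  rcases hρ.eq_or_lt with rfl | hρ'
  · simp [Real.zero_rpow (by linarith : γ ≠ 0)]
  · rw [pressure_eq hρ', mul_comm]
    have := hb ρ hρ hr
    gcongr

theorem continuousOn_flux (hγ : 1 < γ) (hC : 0 < C) : ContinuousOn (flux γ) (stateSet γ C) := by
  obtain ⟨M, hM, hb⟩ := exists_pressure_bound hγ hC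
  have h1 : ContinuousOn (fun u : State => u 1 ^ 2 / u 0 + u 0 ^ γ) (stateSet γ C) := by
    refine continuousOn_stateSet hγ hC (C ^ 2 + M) (fun u hu => ?_) (fun u hu => ?_)
    · exact (((contDiffAt_euclidean.1 (contDiffAt_flux (n := 0) γ hu.1)) 1).continuousAt)
    · have := hb u hu
      obtain ⟨ρ, v, hρ, rfl, hv, hr⟩ := exists_velocity hγ hu
      simp only [Matrix.cons_val_zero, Matrix.cons_val_one] at this ⊢
      have e : (ρ * v) ^ 2 / ρ = ρ * v ^ 2 := by
        rcases hρ.eq_or_lt with rfl | hρ'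
        · simp
        · field_simp
      have h2 : v ^ 2 ≤ C ^ 2 := sq_le_sq' (by linarith [(abs_lt.1 hv).1]) (abs_lt.1 hv).2.le
      rw [e, abs_of_nonneg (by positivity)]
      nlinarith
  have : ContinuousOn (fun u : State => u 1) (stateSet γ C) := by fun_prop
  unfold flux
  fun_prop

theorem continuousOn_entropy (hγ : 1 < γ) (hC : 0 < C) :
    ContinuousOn (entropy γ) (stateSet γ C) := by
  obtain ⟨M, hM, hb⟩ := exists_pressure_bound hγ hC
  have hγ1 : 0 < γ - 1 := by linarith
  refine continuousOn_stateSet hγ hC (C ^ 2 / 2 + M / (γ - 1))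
    (fun u hu => (contDiffAt_entropy (n := 0) γ hu.1).continuousAt) (fun u hu => ?_)
  have := hb u hu
  obtain ⟨ρ, v, hρ, rfl, hv, hr⟩ := exists_velocity hγ hu
  simp only [entropy, Matrix.cons_val_zero, Matrix.cons_val_one] at this ⊢
  have e : (ρ * v) ^ 2 / (2 * ρ) = ρ * v ^ 2 / 2 := by
    rcases hρ.eq_or_lt with rfl | hρ'
    · simp
    · field_simp
  have h2 : v ^ 2 ≤ C ^ 2 := sq_le_sq' (by linarith [(abs_lt.1 hv).1]) (abs_lt.1 hv).2.le
  rw [e, abs_of_nonneg (by positivity)]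
  have h3 : ρ ^ γ / (γ - 1) ≤ M * ρ / (γ - 1) := by gcongr
  have h4 : M / (γ - 1) * ρ = M * ρ / (γ - 1) := by ring
  nlinarith

theorem continuousOn_entropyFlux (hγ : 1 < γ) (hC : 0 < C) :
    ContinuousOn (entropyFlux γ) (stateSet γ C) := by
  obtain ⟨M, hM, hb⟩ := exists_pressure_bound hγ hC
  have hγ1 : 0 < γ - 1 := by linarith
  refine continuousOn_stateSet hγ hC (C ^ 3 / 2 + γ / (γ - 1) * C * M)
    (fun u hu => (contDiffAt_entropyFlux (n := 0) γ hu.1).continuousAt) (fun u hu => ?_)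
  have := hb u hu
  obtain ⟨ρ, v, hρ, rfl, hv, hr⟩ := exists_velocity hγ hu
  simp only [entropyFlux, Matrix.cons_val_zero, Matrix.cons_val_one] at this ⊢
  have e : (ρ * v) ^ 3 / (2 * ρ ^ 2) + γ / (γ - 1) * (ρ * v * ρ ^ (γ - 1)) =
      v * (ρ * v ^ 2 / 2 + γ / (γ - 1) * ρ ^ γ) := by
    rcases hρ.eq_or_lt with rfl | hρ'
    · simp [Real.zero_rpow (by linarith : γ ≠ 0)]
    · rw [pressure_eq hρ' γ]
      generalize ρ ^ (γ - 1) = X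
      field_simp
  have h2 : v ^ 2 ≤ C ^ 2 := sq_le_sq' (by linarith [(abs_lt.1 hv).1]) (abs_lt.1 hv).2.le
  have h5 : 0 < γ / (γ - 1) := by positivity
  rw [e, abs_mul, abs_of_nonneg (by positivity : 0 ≤ ρ * v ^ 2 / 2 + γ / (γ - 1) * ρ ^ γ)]
  calc |v| * (ρ * v ^ 2 / 2 + γ / (γ - 1) * ρ ^ γ)
      ≤ C * (ρ * C ^ 2 / 2 + γ / (γ - 1) * (M * ρ)) := by gcongr
    _ = _ := by ring

/-- The characteristic speeds are bounded on the state set. -/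
theorem exists_charSpeed_bound (hγ : 1 < γ) (hC : 0 < C) :
    ∃ L > 0, ∀ u ∈ region γ C, |charSpeed γ (-1) u| ≤ L ∧ |charSpeed γ 1 u| ≤ L := by
  obtain ⟨M, hM, hb⟩ := exists_density_bound hγ hC
  have hs : 0 < √γ := Real.sqrt_pos.2 (by linarith)
  refine ⟨C + √γ * M ^ ((γ - 1) / 2), by positivity, fun u hu => ?_⟩
  have hu0 := hu.1
  obtain ⟨ρ, v, hρ, rfl, hv, hr⟩ := exists_velocity hγ (region_subset hγ hC hu)
  simp only [Matrix.cons_val_zero] at hu0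
  have hvel : ρ * v / ρ = v := by field_simp
  simp only [charSpeed, Matrix.cons_val_zero, Matrix.cons_val_one, hvel]
  have h0 : 0 ≤ √γ * ρ ^ ((γ - 1) / 2) := by positivity
  have h1 : √γ * ρ ^ ((γ - 1) / 2) ≤ √γ * M ^ ((γ - 1) / 2) := by
    have := hb ρ hρ hr
    have h2 : 0 ≤ (γ - 1) / 2 := by linarith
    gcongr
  obtain ⟨h3, h4⟩ := abs_lt.1 hv
  constructor <;> rw [abs_le] <;> constructor <;> linarith

/-! ### Convexity -/

/-- Multiplied by the density, the bounds on the Riemann invariants compare a convex power of `ρ`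
with linear functions of `(ρ, m)`, which exhibits the convexity of the region. -/
theorem mem_region_iff {u : State} :
    u ∈ region γ C ↔ 0 < u 0 ∧ 2 * √γ / (γ - 1) * u 0 ^ ((γ + 1) / 2) - u 1 < C * u 0 ∧
      2 * √γ / (γ - 1) * u 0 ^ ((γ + 1) / 2) + u 1 < C * u 0 := by
  simp only [region, w₁, w₂, mem_ofPred_eq]
  refine and_congr_right fun h => ?_
  have e : u 0 ^ ((γ + 1) / 2) = u 0 ^ ((γ - 1) / 2) * u 0 := by
    rw [← Real.rpow_add_one h.ne']
    ring_nf
  rw [e]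
  refine and_congr ?_ ?_
  · rw [← mul_lt_mul_iff_left₀ h, sub_mul, div_mul_cancel₀ _ h.ne']
    constructor <;> intro h' <;> linarith
  · rw [← mul_lt_mul_iff_left₀ h, add_mul, div_mul_cancel₀ _ h.ne']
    constructor <;> intro h' <;> linarith

theorem convex_region (hγ : 1 < γ) : Convex ℝ (region γ C) := by
  intro x hx y hy a b ha hb hab
  rw [mem_region_iff] at *
  obtain ⟨hx0, hx1, hx2⟩ := hx
  obtain ⟨hy0, hy1, hy2⟩ := hy
  have hc := riemannCoeff_pos hγ
  have hconv := (convexOn_rpow (p := (γ + 1) / 2) (by linarith)).2 hx0.le hy0.le ha hb hab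
  simp only [smul_eq_mul] at hconv
  have hconv' := mul_le_mul_of_nonneg_left hconv hc.le
  simp only [PiLp.add_apply, PiLp.smul_apply, smul_eq_mul]
  have key : ∀ p q : ℝ, 0 < p → 0 < q → 0 < a * p + b * q := by
    intro p q hp hq
    rcases ha.eq_or_lt with rfl | ha
    · have : b = 1 := by linarith
      subst this
      linarith
    · have := mul_pos ha hp
      have := mul_nonneg hb hq.le
      linarith
  have k1 := key _ _ (sub_pos.2 hx1) (sub_pos.2 hy1)
  have k2 := key _ _ (sub_pos.2 hx2) (sub_pos.2 hy2)
  exact ⟨key _ _ hx0 hy0, by linarith, by linarith⟩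

/-- Only segments ending at the vacuum are new. Scaling by `a ≤ 1` multiplies the power term by `a ^
((γ + 1) / 2) ≤ a` and the linear terms by `a`. -/
theorem convex_stateSet (hγ : 1 < γ) (hC : 0 < C) : Convex ℝ (stateSet γ C) := by
  have hstar : ∀ x ∈ region γ C, ∀ a : ℝ, 0 < a → a ≤ 1 → a • x ∈ region γ C := by
    intro x hx a ha ha1
    rw [mem_region_iff] at *
    obtain ⟨hx0, hx1, hx2⟩ := hx
    have hc := riemannCoeff_pos hγ
    have h1 : a ^ ((γ + 1) / 2) ≤ a := by
      simpa using Real.rpow_le_rpow_of_exponent_ge ha ha1 (by linarith : 1 ≤ (γ + 1) / 2)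
    have h2 : 2 * √γ / (γ - 1) * (a * x 0) ^ ((γ + 1) / 2) ≤
        a * (2 * √γ / (γ - 1) * x 0 ^ ((γ + 1) / 2)) := by
      rw [Real.mul_rpow ha.le hx0.le]
      have := Real.rpow_pos_of_pos hx0 ((γ + 1) / 2)
      have := mul_le_mul_of_nonneg_right h1 (mul_pos hc this).le
      linarith
    simp only [PiLp.smul_apply, smul_eq_mul]
    have k1 := mul_pos ha (sub_pos.2 hx1)
    have k2 := mul_pos ha (sub_pos.2 hx2)
    exact ⟨by positivity, by linarith, by linarith⟩
  rw [stateSet_eq hγ hC, convex_iff_forall_pos]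
  rintro x (rfl | hx) y (rfl | hy) a b ha hb hab
  · simp
  · right
    simpa using hstar y hy b hb (by linarith)
  · right
    simpa using hstar x hx a ha (by linarith)
  · right
    exact convex_region hγ hx hy ha.le hb.le hab

/-- The convexity defect of the kinetic energy is a nonnegative multiple of `(v₁ - v₂)²`, strictly
positive for equal densities and distinct velocities. When the densities differ, the internal energy
is strictly convex. -/
theorem strictConvexOn_entropy (hγ : 1 < γ) (hC : 0 < C) :
    StrictConvexOn ℝ (stateSet γ C) (entropy γ) := by
  have hγ1 : 0 < γ - 1 := by linarith
  refine ⟨convex_stateSet hγ hC, fun x hx y hy hxy a b ha hb hab => ?_⟩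
  obtain ⟨ρ₁, v₁, hρ₁, rfl, -, -⟩ := exists_velocity hγ hx
  obtain ⟨ρ₂, v₂, hρ₂, rfl, -, -⟩ := exists_velocity hγ hy
  have e : ∀ ρ v : ℝ, 0 ≤ ρ → (ρ * v) ^ 2 / (2 * ρ) = ρ * v ^ 2 / 2 := by
    intro ρ v hρ
    rcases hρ.eq_or_lt with rfl | hρ'
    · simp
    · field_simp
  simp only [entropy, PiLp.add_apply, PiLp.smul_apply, smul_eq_mul, Matrix.cons_val_zero,
    Matrix.cons_val_one, e _ _ hρ₁, e _ _ hρ₂]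
  have hpos : 0 < a * ρ₁ + b * ρ₂ := by
    rcases hρ₁.eq_or_lt with rfl | h
    · rcases hρ₂.eq_or_lt with rfl | h
      · simp at hxy
      · have := mul_pos hb h
        linarith
    · have := mul_pos ha h
      have := mul_nonneg hb.le hρ₂
      linarith
  have hquad : a * (ρ₁ * v₁ ^ 2 / 2) + b * (ρ₂ * v₂ ^ 2 / 2) -
      (a * (ρ₁ * v₁) + b * (ρ₂ * v₂)) ^ 2 / (2 * (a * ρ₁ + b * ρ₂)) =
      a * b * (ρ₁ * ρ₂) * (v₁ - v₂) ^ 2 / (2 * (a * ρ₁ + b * ρ₂)) := by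
    field_simp
    ring
  have hq0 : 0 ≤ a * b * (ρ₁ * ρ₂) * (v₁ - v₂) ^ 2 / (2 * (a * ρ₁ + b * ρ₂)) := by positivity
  by_cases hρ : ρ₁ = ρ₂
  · subst hρ
    have hρpos : 0 < ρ₁ := by
      have : a * ρ₁ + b * ρ₁ = ρ₁ := by rw [← add_mul, hab, one_mul]
      rwa [this] at hpos
    have hv : v₁ - v₂ ≠ 0 := by
      intro h
      rw [sub_eq_zero.1 h] at hxy
      exact hxy rfl
    have hq1 : 0 < a * b * (ρ₁ * ρ₁) * (v₁ - v₂) ^ 2 / (2 * (a * ρ₁ + b * ρ₁)) := by positivity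
    have h1 : a * ρ₁ + b * ρ₁ = ρ₁ := by rw [← add_mul, hab, one_mul]
    have h2 : a * (ρ₁ ^ γ / (γ - 1)) + b * (ρ₁ ^ γ / (γ - 1)) = ρ₁ ^ γ / (γ - 1) := by
      rw [← add_mul, hab, one_mul]
    rw [h1] at hquad hq1 ⊢
    linarith
  · have h1 := (strictConvexOn_rpow hγ).2 (mem_Ici.2 hρ₁) (mem_Ici.2 hρ₂) hρ ha hb hab
    simp only [smul_eq_mul] at h1
    have h2 := div_lt_div_of_pos_right h1 hγ1
    rw [add_div, mul_div_assoc, mul_div_assoc] at h2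
    linarith

theorem convexOn_momentumFlux (hγ : 1 < γ) :
    ConvexOn ℝ (region γ C) (fun u : State => u 1 ^ 2 / u 0 + u 0 ^ γ) := by
  refine ⟨convex_region hγ, fun x hx y hy a b ha hb hab => ?_⟩
  have hx0 := hx.1
  have hy0 := hy.1
  have hpos := (convex_region hγ hx hy ha hb hab).1
  have h1 := (convexOn_rpow hγ.le).2 (mem_Ici.2 hx0.le) (mem_Ici.2 hy0.le) ha hb hab
  simp only [PiLp.add_apply, PiLp.smul_apply, smul_eq_mul] at *
  have hquad : a * (x 1 ^ 2 / x 0) + b * (y 1 ^ 2 / y 0) -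
      (a * x 1 + b * y 1) ^ 2 / (a * x 0 + b * y 0) =
      a * b * (x 1 * y 0 - y 1 * x 0) ^ 2 / (x 0 * y 0 * (a * x 0 + b * y 0)) := by
    field_simp
    ring
  have hq0 : 0 ≤ a * b * (x 1 * y 0 - y 1 * x 0) ^ 2 / (x 0 * y 0 * (a * x 0 + b * y 0)) := by
    positivity
  linarith

/-- The first flux component is linear and the second convex, so the sign of the second coefficient
of `ℓ` decides. No eigenvector property is needed. -/
theorem convexOn_or_concaveOn_comp_flux (hγ : 1 < γ) (ℓ : State →L[ℝ] ℝ) :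
    ConvexOn ℝ (region γ C) (fun u => ℓ (flux γ u)) ∨
      ConcaveOn ℝ (region γ C) (fun u => ℓ (flux γ u)) := by
  have e : (fun u => ℓ (flux γ u)) = fun u : State =>
      ℓ (EuclideanSpace.single 0 1) * u 1 +
        ℓ (EuclideanSpace.single 1 1) * (u 1 ^ 2 / u 0 + u 0 ^ γ) := by
    ext u
    have : flux γ u = u 1 • EuclideanSpace.single 0 1 +
        (u 1 ^ 2 / u 0 + u 0 ^ γ) • EuclideanSpace.single 1 1 := by
      apply state_ext <;> simp [flux]
    rw [this, map_add, map_smul, map_smul]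
    simp only [smul_eq_mul]
    ring
  have hlin : ∀ c : ℝ, ∀ x y : State, ∀ a b : ℝ,
      c * (a • x + b • y) 1 = a * (c * x 1) + b * (c * y 1) := by
    intro c x y a b
    simp only [PiLp.add_apply, PiLp.smul_apply, smul_eq_mul]
    ring
  have hm := convexOn_momentumFlux (C := C) hγ
  rw [e]
  rcases le_total 0 (ℓ (EuclideanSpace.single 1 1)) with h | h
  · left
    refine ConvexOn.add ⟨convex_region hγ, fun x _ y _ a b _ _ _ => (hlin _ x y a b).le⟩ ?_
    exact hm.smul h
  · right
    refine ConcaveOn.add ⟨convex_region hγ, fun x _ y _ a b _ _ _ => (hlin _ x y a b).ge⟩ ?_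
    rw [← neg_convexOn_iff]
    refine (hm.smul (neg_nonneg.2 h)).congr fun u _ => ?_
    simp

/-! ### Derivatives, eigenvalues and the entropy pair -/

theorem hasDerivAt_line (u r : State) : HasDerivAt (fun t : ℝ => u + t • r) r 0 := by
  simpa using ((hasDerivAt_id (0 : ℝ)).smul_const r).const_add u

theorem fderiv_apply_eq_of_hasDerivAt {F : Type*} [NormedAddCommGroup F] [NormedSpace ℝ F]
    {g : State → F} {u r : State} {c : F} (hg : DifferentiableAt ℝ g u)
    (h : HasDerivAt (fun t : ℝ => g (u + t • r)) c 0) : fderiv ℝ g u r = c := by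
  have hg' : HasFDerivAt g (fderiv ℝ g u) (u + (0 : ℝ) • r) := by simpa using hg.hasFDerivAt
  exact (hg'.comp_hasDerivAt 0 (hasDerivAt_line u r)).unique h

theorem hasDerivAt_coord (u r : State) (i : Fin 2) :
    HasDerivAt (fun t : ℝ => (u + t • r) i) (r i) 0 := by
  simpa using ((hasDerivAt_id (0 : ℝ)).mul_const (r i)).const_add (u i)

theorem hasDerivAt_density_rpow (p : ℝ) {u : State} (r : State) (hu : 0 < u 0) :
    HasDerivAt (fun t : ℝ => ((u + t • r) 0) ^ p) (r 0 * p * u 0 ^ (p - 1)) 0 := by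
  simpa using (hasDerivAt_coord u r 0).rpow_const (p := p) (Or.inl (by simpa using hu.ne'))

theorem fderiv_flux_zero (γ : ℝ) {u : State} (r : State) (hu : 0 < u 0) :
    fderiv ℝ (flux γ) u r 0 = r 1 := by
  have h := (contDiffAt_flux (n := 1) γ hu).differentiableAt one_ne_zero
  have h' : HasFDerivAt (flux γ) (fderiv ℝ (flux γ) u) (u + (0 : ℝ) • r) := by
    simpa using h.hasFDerivAt
  have h2 := h'.comp_hasDerivAt 0 (hasDerivAt_line u r)
  have h3 := (EuclideanSpace.proj (𝕜 := ℝ) (0 : Fin 2)).hasFDerivAt.comp_hasDerivAt 0 h2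
  exact h3.unique (hasDerivAt_coord u r 1)

theorem fderiv_flux_one (γ : ℝ) {u : State} (r : State) (hu : 0 < u 0) :
    fderiv ℝ (flux γ) u r 1 =
      (-(u 1 / u 0) ^ 2 + γ * u 0 ^ (γ - 1)) * r 0 + 2 * (u 1 / u 0) * r 1 := by
  have h := (contDiffAt_flux (n := 1) γ hu).differentiableAt one_ne_zero
  have h' : HasFDerivAt (flux γ) (fderiv ℝ (flux γ) u) (u + (0 : ℝ) • r) := by
    simpa using h.hasFDerivAt
  have h2 := h'.comp_hasDerivAt 0 (hasDerivAt_line u r)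
  have h3 := (EuclideanSpace.proj (𝕜 := ℝ) (1 : Fin 2)).hasFDerivAt.comp_hasDerivAt 0 h2
  have h4 := (((hasDerivAt_coord u r 1).fun_pow 2).fun_div (hasDerivAt_coord u r 0)
    (by simpa using hu.ne')).add (hasDerivAt_density_rpow γ r hu)
  refine (h3.unique h4).trans ?_
  simp
  field_simp
  ring

theorem fderiv_charSpeed (γ ε : ℝ) {u : State} (r : State) (hu : 0 < u 0) :
    fderiv ℝ (charSpeed γ ε) u r = (r 1 * u 0 - u 1 * r 0) / u 0 ^ 2 +
      ε * (√γ * (r 0 * ((γ - 1) / 2) * u 0 ^ ((γ - 1) / 2 - 1))) := by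
  have hd : DifferentiableAt ℝ (charSpeed γ ε) u := by
    have h : ContDiffAt ℝ 1 (fun u : State => u 1 / u 0) u :=
      ContDiffAt.div (by fun_prop) (by fun_prop) hu.ne'
    have : ContDiffAt ℝ 1 (charSpeed γ ε) u :=
      h.add (contDiffAt_const.mul (contDiffAt_const.mul (contDiffAt_density_rpow _ hu)))
    exact this.differentiableAt one_ne_zero
  refine fderiv_apply_eq_of_hasDerivAt hd ?_
  have h := ((hasDerivAt_coord u r 1).fun_div (hasDerivAt_coord u r 0)
    (by simpa using hu.ne')).add
      (((hasDerivAt_density_rpow ((γ - 1) / 2) r hu).const_mul √γ).const_mul ε)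
  refine h.congr_deriv ?_
  simp

theorem fderiv_entropy (hγ : 1 < γ) {u : State} (r : State) (hu : 0 < u 0) :
    fderiv ℝ (entropy γ) u r =
      (-(u 1 / u 0) ^ 2 / 2 + γ / (γ - 1) * u 0 ^ (γ - 1)) * r 0 + u 1 / u 0 * r 1 := by
  have hγ1 : γ - 1 ≠ 0 := by linarith
  refine fderiv_apply_eq_of_hasDerivAt
    ((contDiffAt_entropy (n := 1) γ hu).differentiableAt one_ne_zero) ?_
  have h := (((hasDerivAt_coord u r 1).fun_pow 2).fun_div ((hasDerivAt_coord u r 0).const_mul 2)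
    (by simpa using hu.ne')).add ((hasDerivAt_density_rpow γ r hu).div_const (γ - 1))
  refine h.congr_deriv ?_
  simp
  field_simp
  ring

theorem fderiv_entropyFlux (hγ : 1 < γ) {u : State} (r : State) (hu : 0 < u 0) :
    fderiv ℝ (entropyFlux γ) u r =
      (-(u 1 / u 0) ^ 3 + u 1 / u 0 * (γ * u 0 ^ (γ - 1))) * r 0 +
        (3 / 2 * (u 1 / u 0) ^ 2 + γ / (γ - 1) * u 0 ^ (γ - 1)) * r 1 := by
  have hγ1 : γ - 1 ≠ 0 := by linarith
  refine fderiv_apply_eq_of_hasDerivAt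
    ((contDiffAt_entropyFlux (n := 1) γ hu).differentiableAt one_ne_zero) ?_
  have h := (((hasDerivAt_coord u r 1).fun_pow 3).fun_div
    (((hasDerivAt_coord u r 0).fun_pow 2).const_mul 2) (by simpa using hu.ne')).add
      (((hasDerivAt_coord u r 1).fun_mul (hasDerivAt_density_rpow (γ - 1) r hu)).const_mul
        (γ / (γ - 1)))
  refine h.congr_deriv ?_
  have e : u 0 ^ (γ - 1) = u 0 * u 0 ^ (γ - 1 - 1) := pressure_eq hu _
  simp
  rw [e]
  generalize u 0 ^ (γ - 1 - 1) = X
  field_simp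
  ring

theorem fderiv_fderiv_entropy (hγ : 1 < γ) {u : State} (w : State) (hu : 0 < u 0) :
    fderiv ℝ (fderiv ℝ (entropy γ)) u w w =
      (w 1 - u 1 / u 0 * w 0) ^ 2 / u 0 + γ * u 0 ^ (γ - 1 - 1) * w 0 ^ 2 := by
  have hγ1 : γ - 1 ≠ 0 := by linarith
  have hd : DifferentiableAt ℝ (fderiv ℝ (entropy γ)) u :=
    ((contDiffAt_entropy (n := 2) γ hu).fderiv_right (m := 1) (by norm_num)).differentiableAt
      one_ne_zero
  have hd' : DifferentiableAt ℝ (fun y => fderiv ℝ (entropy γ) y w) u :=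
    hd.clm_apply (differentiableAt_const w)
  have e1 : fderiv ℝ (fderiv ℝ (entropy γ)) u w w =
      fderiv ℝ (fun y => fderiv ℝ (entropy γ) y w) u w := by
    have := (hd.hasFDerivAt.clm_apply (hasFDerivAt_const w u)).fderiv
    rw [this]
    simp
  rw [e1]
  refine fderiv_apply_eq_of_hasDerivAt hd' ?_
  have hv := (hasDerivAt_coord u w 1).fun_div (hasDerivAt_coord u w 0) (by simpa using hu.ne')
  have h := (((((hv.fun_pow 2).neg).div_const 2).add
    ((hasDerivAt_density_rpow (γ - 1) w hu).const_mul (γ / (γ - 1)))).mul_const (w 0)).add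
      (hv.mul_const (w 1))
  -- The formula for the gradient requires positive density, so it is used only near `t = 0`.
  have hev : ∀ᶠ t in 𝓝 (0 : ℝ), 0 < (u + t • w) 0 := by
    have : ContinuousAt (fun t : ℝ => (u + t • w) 0) 0 := (hasDerivAt_coord u w 0).continuousAt
    exact this.eventually_const_lt (by simpa using hu)
  refine HasDerivAt.congr_of_eventuallyEq ?_
    (hev.mono fun t ht => fderiv_entropy hγ w ht)
  refine h.congr_deriv ?_
  simp
  generalize u 0 ^ (γ - 1 - 1) = X
  field_simp
  ring

theorem posDef_entropy (hγ : 1 < γ) {u w : State} (hu : 0 < u 0) (hw : w ≠ 0) :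
    0 < fderiv ℝ (fderiv ℝ (entropy γ)) u w w := by
  rw [fderiv_fderiv_entropy hγ w hu]
  have hX := Real.rpow_pos_of_pos hu (γ - 1 - 1)
  have hγ0 : 0 < γ := by linarith
  by_cases h0 : w 0 = 0
  · have h1 : w 1 ≠ 0 := fun h1 => hw (state_ext (by simpa using h0) (by simpa using h1))
    rw [h0]
    simp only [mul_zero, sub_zero]
    positivity
  · positivity

theorem entropyFlux_compat (hγ : 1 < γ) {u : State} (hu : 0 < u 0) :
    fderiv ℝ (entropyFlux γ) u = fderiv ℝ (entropy γ) u ∘L fderiv ℝ (flux γ) u := by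
  ext r : 1
  rw [ContinuousLinearMap.comp_apply, fderiv_entropyFlux hγ r hu, fderiv_entropy hγ _ hu,
    fderiv_flux_zero γ r hu, fderiv_flux_one γ r hu]
  ring

/-- This is the characteristic equation of the Jacobian, solved for both signs at once by `ε² = 1`.
-/
theorem charSpeed_quadratic (hγ : 1 < γ) {ε : ℝ} (hε : ε ^ 2 = 1) {u : State} (hu : 0 < u 0) :
    -(u 1 / u 0) ^ 2 + γ * u 0 ^ (γ - 1) + 2 * (u 1 / u 0) * charSpeed γ ε u =
      charSpeed γ ε u ^ 2 := by
  rw [← sound_sq hu.le]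
  simp only [charSpeed]
  have h1 := Real.sq_sqrt (by linarith : (0 : ℝ) ≤ γ)
  linear_combination (-(u 0 ^ ((γ - 1) / 2)) ^ 2) * h1 -
    (√γ * u 0 ^ ((γ - 1) / 2)) ^ 2 * hε

theorem hasEigenvalue_flux (hγ : 1 < γ) {ε : ℝ} (hε : ε ^ 2 = 1) {u : State} (hu : 0 < u 0) :
    Module.End.HasEigenvalue (fderiv ℝ (flux γ) u).toLinearMap (charSpeed γ ε u) := by
  refine Module.End.hasEigenvalue_of_hasEigenvector (x := !₂[1, charSpeed γ ε u])
    (Module.End.hasEigenvector_iff.2 ⟨Module.End.mem_eigenspace_iff.2 ?_, fun h => ?_⟩)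
  · apply state_ext
    · simpa using fderiv_flux_zero γ !₂[1, charSpeed γ ε u] hu
    · have h1 := fderiv_flux_one γ !₂[1, charSpeed γ ε u] hu
      have h2 := charSpeed_quadratic hγ hε hu
      simp at h1 ⊢
      rw [h1]
      linarith
  · have := congrArg (fun x : State => x 0) h
    simp at this

/-- An eigenvector is a nonzero multiple of `(1, λ)`, along which the speed varies at rate `ε √γ (γ
+ 1) / 2 * ρ ^ ((γ - 3) / 2)`. -/
theorem genuinely_nonlinear (hγ : 1 < γ) {ε : ℝ} (hε : ε ^ 2 = 1) {u r : State} (hu : 0 < u 0)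
    (hr : Module.End.HasEigenvector (fderiv ℝ (flux γ) u).toLinearMap (charSpeed γ ε u) r) :
    fderiv ℝ (charSpeed γ ε) u r ≠ 0 := by
  have h1 : r 1 = charSpeed γ ε u * r 0 := by
    have := congrArg (fun x : State => x 0) hr.apply_eq_smul
    simp at this
    rw [← this, fderiv_flux_zero γ r hu]
  have h0 : r 0 ≠ 0 := fun h0 => hr.2 (state_ext (by simpa using h0) (by simp [h1, h0]))
  have hε0 : ε ≠ 0 := by
    rintro rfl
    norm_num at hε
  have hs : 0 < √γ := Real.sqrt_pos.2 (by linarith)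
  have hX := Real.rpow_pos_of_pos hu ((γ - 1) / 2 - 1)
  have e : fderiv ℝ (charSpeed γ ε) u r =
      ε * (r 0 * (√γ * ((γ + 1) / 2) * u 0 ^ ((γ - 1) / 2 - 1))) := by
    rw [fderiv_charSpeed γ ε r hu, h1, charSpeed, pressure_eq hu ((γ - 1) / 2)]
    generalize u 0 ^ ((γ - 1) / 2 - 1) = X
    field_simp
    ring
  rw [e]
  have : 0 < √γ * ((γ + 1) / 2) * u 0 ^ ((γ - 1) / 2 - 1) := by
    have : 0 < γ + 1 := by linarith
    positivity
  exact mul_ne_zero hε0 (mul_ne_zero h0 this.ne')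

/-! ### Mass flux across a shock and convexity of the pressure -/

/-- `(σ - v)²` for a shock of speed `σ` from `(a, a v)` to a state of density `ρ`. -/
noncomputable def massFluxSq (γ a ρ : ℝ) : ℝ := ρ / a * ((ρ ^ γ - a ^ γ) / (ρ - a))

/-- The jump of the velocity across a shock between the densities `a` and `ρ`. -/
noncomputable def velocityJump (γ a ρ : ℝ) : ℝ := √((1 / a - 1 / ρ) * (ρ ^ γ - a ^ γ))

/-- The entropy dissipation across a shock per unit of mass flux. -/
noncomputable def dissipation (γ a ρ : ℝ) : ℝ :=
  γ / (γ - 1) * (ρ ^ (γ - 1) - a ^ (γ - 1)) - (ρ ^ γ - a ^ γ) * (1 / ρ + 1 / a) / 2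

theorem hasDerivAt_pressure (γ : ℝ) {ρ : ℝ} (hρ : 0 < ρ) :
    HasDerivAt (fun x : ℝ => x ^ γ) (γ * ρ ^ (γ - 1)) ρ :=
  Real.hasDerivAt_rpow_const (Or.inl hρ.ne')

theorem soundSpeed_lt_slope (hγ : 1 < γ) {a ρ : ℝ} (ha : 0 < a) (hρ : a < ρ) :
    γ * a ^ (γ - 1) < (ρ ^ γ - a ^ γ) / (ρ - a) := by
  have := (strictConvexOn_rpow hγ).lt_slope_of_hasDerivAt (mem_Ici.2 ha.le)
    (mem_Ici.2 (ha.trans hρ).le) hρ (hasDerivAt_pressure γ ha)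
  rwa [slope_def_field] at this

theorem slope_lt_soundSpeed (hγ : 1 < γ) {a ρ : ℝ} (ha : 0 < a) (hρ : a < ρ) :
    (ρ ^ γ - a ^ γ) / (ρ - a) < γ * ρ ^ (γ - 1) := by
  have := (strictConvexOn_rpow hγ).slope_lt_of_hasDerivAt (mem_Ici.2 ha.le)
    (mem_Ici.2 (ha.trans hρ).le) hρ (hasDerivAt_pressure γ (ha.trans hρ))
  rwa [slope_def_field] at this

theorem massFluxSq_symm (γ : ℝ) {a ρ : ℝ} (ha : 0 < a) (hρ : 0 < ρ) :
    massFluxSq γ ρ a = (a / ρ) ^ 2 * massFluxSq γ a ρ := by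
  have : (a ^ γ - ρ ^ γ) / (a - ρ) = (ρ ^ γ - a ^ γ) / (ρ - a) := by
    rw [← neg_sub, ← neg_sub ρ a, neg_div_neg_eq]
  simp only [massFluxSq]
  rw [this]
  field_simp

/-- The secant slope of the pressure exceeds its left tangent slope, and `ρ / a > 1`. This says that
the state ahead of a compressive shock is supersonic relative to it. -/
theorem soundSpeed_lt_massFluxSq (hγ : 1 < γ) {a ρ : ℝ} (ha : 0 < a) (hρ : a < ρ) :
    γ * a ^ (γ - 1) < massFluxSq γ a ρ := by
  have h1 := soundSpeed_lt_slope hγ ha hρ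
  have h2 : 1 < ρ / a := (one_lt_div ha).2 hρ
  have h3 : 0 < γ * a ^ (γ - 1) := mul_pos (by linarith) (Real.rpow_pos_of_pos ha _)
  simp only [massFluxSq]
  nlinarith

/-- The counterpart behind the shock: the flow there is subsonic. -/
theorem massFluxSq_lt_soundSpeed (hγ : 1 < γ) {a ρ : ℝ} (ha : 0 < a) (hρ : a < ρ) :
    massFluxSq γ ρ a < γ * ρ ^ (γ - 1) := by
  have hρ0 := ha.trans hρ
  have e : massFluxSq γ ρ a = a / ρ * ((ρ ^ γ - a ^ γ) / (ρ - a)) := by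
    rw [massFluxSq_symm γ ha hρ0, massFluxSq]
    field_simp
  have h1 := slope_lt_soundSpeed hγ ha hρ
  have h2 : a / ρ < 1 := (div_lt_one hρ0).2 hρ
  have h0 : 0 < a / ρ := by positivity
  have h3 : 0 < γ * ρ ^ (γ - 1) := mul_pos (by linarith) (Real.rpow_pos_of_pos hρ0 _)
  rw [e]
  nlinarith

theorem massFluxSq_pos (hγ : 1 < γ) {a ρ : ℝ} (ha : 0 < a) (hρ : 0 < ρ) (hne : a ≠ ρ) :
    0 < massFluxSq γ a ρ := by
  rcases lt_or_gt_of_ne hne with h | h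
  · exact (mul_pos (by linarith) (Real.rpow_pos_of_pos ha _)).trans
      (soundSpeed_lt_massFluxSq hγ ha h)
  · rw [massFluxSq_symm γ hρ ha]
    have := (mul_pos (by linarith) (Real.rpow_pos_of_pos hρ _)).trans
      (soundSpeed_lt_massFluxSq hγ hρ h)
    positivity

/-- The derivative of `massFluxSq γ a` at `ρ`. -/
noncomputable def massFluxSqDeriv (γ a ρ : ℝ) : ℝ :=
  1 / a * ((ρ ^ γ - a ^ γ) / (ρ - a)) +
    ρ / a * ((γ * ρ ^ (γ - 1) - (ρ ^ γ - a ^ γ) / (ρ - a)) / (ρ - a))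

theorem hasDerivAt_massFluxSq (γ : ℝ) {a ρ : ℝ} (ha : 0 < a) (hρ : a < ρ) :
    HasDerivAt (massFluxSq γ a) (massFluxSqDeriv γ a ρ) ρ := by
  have hne : ρ - a ≠ 0 := (sub_pos.2 hρ).ne'
  have h := ((hasDerivAt_id ρ).div_const a).fun_mul
    (((hasDerivAt_pressure γ (ha.trans hρ)).sub_const (a ^ γ)).fun_div
      ((hasDerivAt_id ρ).sub_const a) hne)
  refine h.congr_deriv ?_
  simp only [massFluxSqDeriv, id]
  field_simp

theorem massFluxSqDeriv_pos (hγ : 1 < γ) {a ρ : ℝ} (ha : 0 < a) (hρ : a < ρ) :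
    0 < massFluxSqDeriv γ a ρ := by
  have h1 := soundSpeed_lt_slope hγ ha hρ
  have h2 := slope_lt_soundSpeed hγ ha hρ
  have h3 : 0 < γ * a ^ (γ - 1) := mul_pos (by linarith) (Real.rpow_pos_of_pos ha _)
  have h4 := sub_pos.2 hρ
  have h5 := ha.trans hρ
  have h6 := sub_pos.2 h2
  have h7 := h3.trans h1
  have := div_pos h6 h4
  simp only [massFluxSqDeriv]
  positivity

/-- Replacing the secant slope by tangent slopes gives a bound that is continuous up to `ρ = a` and
vanishes there. It controls the variation of the shock speed for weak shocks. -/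
theorem mul_massFluxSqDeriv_le (hγ : 1 < γ) {a ρ : ℝ} (ha : 0 < a) (hρ : a < ρ) :
    (ρ - a) * massFluxSqDeriv γ a ρ ≤
      (ρ - a) / a * (γ * ρ ^ (γ - 1)) + ρ / a * (γ * ρ ^ (γ - 1) - γ * a ^ (γ - 1)) := by
  have h1 := soundSpeed_lt_slope hγ ha hρ
  have h2 := slope_lt_soundSpeed hγ ha hρ
  have h4 := sub_pos.2 hρ
  have h5 := ha.trans hρ
  have e : (ρ - a) * massFluxSqDeriv γ a ρ = (ρ - a) / a * ((ρ ^ γ - a ^ γ) / (ρ - a)) +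
      ρ / a * (γ * ρ ^ (γ - 1) - (ρ ^ γ - a ^ γ) / (ρ - a)) := by
    simp only [massFluxSqDeriv]
    generalize (ρ ^ γ - a ^ γ) / (ρ - a) = M
    field_simp
  rw [e]
  gcongr

/-! ### The velocity jump -/

theorem velocityJump_nonneg (γ a ρ : ℝ) : 0 ≤ velocityJump γ a ρ := Real.sqrt_nonneg _

theorem velocityJump_self (γ a : ℝ) : velocityJump γ a a = 0 := by simp [velocityJump]

theorem velocityJump_sq_pos (hγ : 1 < γ) {a ρ : ℝ} (ha : 0 < a) (hρ : a < ρ) :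
    0 < (1 / a - 1 / ρ) * (ρ ^ γ - a ^ γ) :=
  mul_pos (sub_pos.2 (one_div_lt_one_div_of_lt ha hρ))
    (sub_pos.2 (Real.rpow_lt_rpow ha.le hρ (by linarith)))

/-- This passes from the shock speed to the velocity drop. It includes `ρ = a`, where `massFluxSq`
is only a division by zero but `velocityJump` is continuous. -/
theorem mul_sqrt_massFluxSq (hγ : 1 < γ) {a ρ : ℝ} (ha : 0 < a) (hρ : a ≤ ρ) :
    (ρ - a) * √(massFluxSq γ a ρ) = ρ * velocityJump γ a ρ := by
  rcases hρ.eq_or_lt with rfl | hρ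
  · simp [velocityJump_self]
  have h4 := sub_pos.2 hρ
  have h5 := ha.trans hρ
  have h0 := massFluxSq_pos hγ ha h5 hρ.ne
  have h1 := velocityJump_sq_pos hγ ha hρ
  rw [velocityJump, ← Real.sqrt_sq h4.le, ← Real.sqrt_sq h5.le, Real.sqrt_sq h5.le,
    ← Real.sqrt_mul (sq_nonneg _), ← Real.sqrt_sq h5.le, ← Real.sqrt_mul (sq_nonneg _),
    Real.sqrt_sq h5.le]
  congr 1
  simp only [massFluxSq]
  field_simp

/-- The square of the jump has derivative `X + Y` with `X = Δp / ρ²` and `Y = (1 / a - 1 / ρ)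
p'(ρ)`. Its product form gives `X Y = jump² * p'(ρ) / ρ²`, so AM-GM bounds the derivative of the
jump below by `√p'(ρ) / ρ`, the derivative of the sound term in the Riemann invariants. -/
theorem hasDerivAt_velocityJump (hγ : 1 < γ) {a ρ : ℝ} (ha : 0 < a) (hρ : a < ρ) :
    ∃ d, √γ * ρ ^ ((γ - 1) / 2 - 1) ≤ d ∧ HasDerivAt (velocityJump γ a) d ρ := by
  have hρ0 := ha.trans hρ
  have hpos := velocityJump_sq_pos hγ ha hρ
  have h := ((((hasDerivAt_inv hρ0.ne').const_sub (1 / a)).fun_mul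
    ((hasDerivAt_pressure γ hρ0).sub_const (a ^ γ))).sqrt (by simpa using hpos.ne'))
  have hfun : (fun y : ℝ => √((1 / a - y⁻¹) * (y ^ γ - a ^ γ))) = velocityJump γ a := by
    ext y
    simp [velocityJump]
  rw [hfun] at h
  refine ⟨_, ?_, h⟩
  have hD : 0 < velocityJump γ a ρ := Real.sqrt_pos.2 hpos
  have hDsq : velocityJump γ a ρ ^ 2 = (1 / a - 1 / ρ) * (ρ ^ γ - a ^ γ) := Real.sq_sqrt hpos.le
  have hfold : √((1 / a - ρ⁻¹) * (ρ ^ γ - a ^ γ)) = velocityJump γ a ρ := by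
    simp [velocityJump]
  rw [hfold, le_div_iff₀ (by positivity)]
  have hS2 : (√γ * ρ ^ ((γ - 1) / 2 - 1)) ^ 2 * ρ ^ 2 = γ * ρ ^ (γ - 1) := by
    rw [← sound_sq hρ0.le γ, pressure_eq hρ0 ((γ - 1) / 2), mul_pow,
      Real.sq_sqrt (by linarith : (0 : ℝ) ≤ γ)]
    ring
  have hX : 0 ≤ (ρ ^ γ - a ^ γ) / ρ ^ 2 := div_nonneg
    (sub_pos.2 (Real.rpow_lt_rpow ha.le hρ (by linarith))).le (by positivity)
  have hY : 0 ≤ (1 / a - 1 / ρ) * (γ * ρ ^ (γ - 1)) :=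
    mul_nonneg (sub_pos.2 (one_div_lt_one_div_of_lt ha hρ)).le
      (mul_pos (by linarith) (Real.rpow_pos_of_pos hρ0 _)).le
  have e : - -(ρ ^ 2)⁻¹ * (ρ ^ γ - a ^ γ) + (1 / a - ρ⁻¹) * (γ * ρ ^ (γ - 1)) =
      (ρ ^ γ - a ^ γ) / ρ ^ 2 + (1 / a - 1 / ρ) * (γ * ρ ^ (γ - 1)) := by
    simp only [one_div]
    ring
  rw [e]
  refine abs_le_of_sq_le_sq' ?_ (add_nonneg hX hY) |>.2
  have e2 : (√γ * ρ ^ ((γ - 1) / 2 - 1) * (2 * velocityJump γ a ρ)) ^ 2 =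
      4 * ((ρ ^ γ - a ^ γ) / ρ ^ 2 * ((1 / a - 1 / ρ) * (γ * ρ ^ (γ - 1)))) := by
    rw [← hS2, mul_pow, mul_pow 2, hDsq]
    field_simp
    ring
  rw [e2]
  nlinarith [sq_nonneg ((ρ ^ γ - a ^ γ) / ρ ^ 2 - (1 / a - 1 / ρ) * (γ * ρ ^ (γ - 1)))]

theorem continuousOn_velocityJump (γ : ℝ) {a : ℝ} (ha : 0 < a) :
    ContinuousOn (velocityJump γ a) (Ici a) := by
  have h1 : ContinuousOn (fun ρ : ℝ => 1 / ρ) (Ici a) :=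
    continuousOn_const.div continuousOn_id fun x hx => (ha.trans_le hx).ne'
  have h2 : ContinuousOn (fun ρ : ℝ => ρ ^ γ) (Ici a) :=
    continuousOn_id.rpow_const fun x hx => Or.inl (ha.trans_le hx).ne'
  exact ((continuousOn_const.sub h1).mul (h2.sub continuousOn_const)).sqrt

theorem hasDerivAt_riemann (hγ : 1 < γ) {ρ : ℝ} (hρ : 0 < ρ) :
    HasDerivAt (fun ρ : ℝ => 2 * √γ / (γ - 1) * ρ ^ ((γ - 1) / 2))
      (√γ * ρ ^ ((γ - 1) / 2 - 1)) ρ := by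
  have hγ1 : γ - 1 ≠ 0 := by linarith
  refine ((hasDerivAt_pressure ((γ - 1) / 2) hρ).const_mul (2 * √γ / (γ - 1))).congr_deriv ?_
  field_simp

theorem continuousOn_riemann (γ : ℝ) {a : ℝ} (ha : 0 < a) :
    ContinuousOn (fun ρ : ℝ => 2 * √γ / (γ - 1) * ρ ^ ((γ - 1) / 2)) (Ici a) :=
  continuousOn_const.mul
    (continuousOn_id.rpow_const fun _ hx => Or.inl (ha.trans_le hx).ne')

/-- Equivalently, `w₂` does not increase along the 1-shock curve. -/
theorem monotoneOn_velocityJump_sub (hγ : 1 < γ) {a : ℝ} (ha : 0 < a) :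
    MonotoneOn (fun ρ => velocityJump γ a ρ - 2 * √γ / (γ - 1) * ρ ^ ((γ - 1) / 2)) (Ici a) := by
  have hd : ∀ ρ ∈ interior (Ici a), ∃ d, 0 ≤ d ∧ HasDerivAt
      (fun ρ => velocityJump γ a ρ - 2 * √γ / (γ - 1) * ρ ^ ((γ - 1) / 2)) d ρ := by
    intro ρ hρ
    rw [interior_Ici] at hρ
    obtain ⟨d, hd, h⟩ := hasDerivAt_velocityJump hγ ha hρ
    exact ⟨_, sub_nonneg.2 hd, h.sub (hasDerivAt_riemann hγ (ha.trans hρ))⟩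
  refine monotoneOn_of_deriv_nonneg (convex_Ici a)
    ((continuousOn_velocityJump γ ha).sub (continuousOn_riemann γ ha)) ?_ ?_
  · intro ρ hρ
    obtain ⟨d, -, h⟩ := hd ρ hρ
    exact h.differentiableAt.differentiableWithinAt
  · intro ρ hρ
    obtain ⟨d, h0, h⟩ := hd ρ hρ
    rwa [h.deriv]

theorem strictMonoOn_riemann (hγ : 1 < γ) {a : ℝ} (ha : 0 < a) :
    StrictMonoOn (fun ρ : ℝ => 2 * √γ / (γ - 1) * ρ ^ ((γ - 1) / 2)) (Ici a) := by
  intro x hx y hy hxy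
  have : x ^ ((γ - 1) / 2) < y ^ ((γ - 1) / 2) :=
    Real.rpow_lt_rpow (ha.le.trans hx) hxy (by linarith)
  exact mul_lt_mul_of_pos_left this (riemannCoeff_pos hγ)

/-- Equivalently, `w₁` strictly decreases along the 1-shock curve. -/
theorem strictMonoOn_velocityJump_add (hγ : 1 < γ) {a : ℝ} (ha : 0 < a) :
    StrictMonoOn (fun ρ => velocityJump γ a ρ + 2 * √γ / (γ - 1) * ρ ^ ((γ - 1) / 2))
      (Ici a) := by
  intro x hx y hy hxy
  have h1 := monotoneOn_velocityJump_sub hγ ha hx hy hxy.le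
  have h2 := strictMonoOn_riemann hγ ha hx hy hxy
  simp only at h1 h2 ⊢
  linarith

/-! ### Entropy dissipation -/

/-- The dissipation vanishes at `ρ = a`, and its derivative is negative because the secant slope of
the pressure is below `p'(x)` and `x / a > 1`. -/
theorem dissipation_neg (hγ : 1 < γ) {a ρ : ℝ} (ha : 0 < a) (hρ : a < ρ) :
    dissipation γ a ρ < 0 := by
  have hγ1 : γ - 1 ≠ 0 := by linarith
  have hd : ∀ x ∈ Ioi a, HasDerivAt (dissipation γ a)
      (((x ^ γ - a ^ γ) - γ * x ^ (γ - 1) * (x - a) * (x / a)) / (2 * x ^ 2)) x := by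
    intro x hx
    have hx0 : 0 < x := ha.trans hx
    have h1 := ((hasDerivAt_pressure (γ - 1) hx0).sub_const (a ^ (γ - 1))).const_mul (γ / (γ - 1))
    have h2 := (((hasDerivAt_pressure γ hx0).sub_const (a ^ γ)).fun_mul
      ((hasDerivAt_inv hx0.ne').add_const (1 / a))).div_const 2
    have h3 := h1.fun_sub h2
    have hfun : (fun y : ℝ => γ / (γ - 1) * (y ^ (γ - 1) - a ^ (γ - 1)) -
        (y ^ γ - a ^ γ) * (y⁻¹ + 1 / a) / 2) = dissipation γ a := by
      ext y
      simp [dissipation]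
    rw [hfun] at h3
    refine h3.congr_deriv ?_
    rw [pressure_eq hx0 (γ - 1)]
    generalize x ^ (γ - 1 - 1) = X
    generalize x ^ γ = Y
    field_simp
    ring
  have hneg : ∀ x ∈ interior (Ici a), deriv (dissipation γ a) x < 0 := by
    intro x hx
    rw [interior_Ici] at hx
    have hx' : a < x := hx
    rw [(hd x hx).deriv]
    have hx0 : 0 < x := ha.trans hx
    refine div_neg_of_neg_of_pos ?_ (by positivity)
    have h1 := slope_lt_soundSpeed hγ ha hx
    rw [div_lt_iff₀ (sub_pos.2 hx')] at h1
    have h2 : 1 < x / a := (one_lt_div ha).2 hx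
    have h3 : 0 < γ * x ^ (γ - 1) * (x - a) := mul_pos
      (mul_pos (by linarith) (Real.rpow_pos_of_pos hx0 _)) (sub_pos.2 hx')
    nlinarith
  have hc : ContinuousOn (dissipation γ a) (Ici a) := by
    have h0 : ∀ x ∈ Ici a, x ≠ 0 := fun x hx => (ha.trans_le hx).ne'
    have h1 : ContinuousOn (fun ρ : ℝ => 1 / ρ) (Ici a) :=
      continuousOn_const.div continuousOn_id h0
    have h2 : ∀ p : ℝ, ContinuousOn (fun ρ : ℝ => ρ ^ p) (Ici a) := fun p =>
      continuousOn_id.rpow_const fun x hx => Or.inl (h0 x hx)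
    exact (continuousOn_const.mul ((h2 _).sub continuousOn_const)).sub
      ((((h2 _).sub continuousOn_const).mul (h1.add continuousOn_const)).div_const _)
  have := strictAntiOn_of_deriv_neg (convex_Ici a) hc hneg (mem_Ici.2 le_rfl) (mem_Ici.2 hρ.le) hρ
  simpa [dissipation] using this

theorem dissipation_symm (γ a ρ : ℝ) : dissipation γ ρ a = -dissipation γ a ρ := by
  simp only [dissipation]
  ring

theorem mul_dissipation_neg (hγ : 1 < γ) {a ρ : ℝ} (ha : 0 < a) (hρ : 0 < ρ) (hne : a ≠ ρ) :
    (ρ - a) * dissipation γ a ρ < 0 := by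
  rcases lt_or_gt_of_ne hne with h | h
  · exact mul_neg_of_pos_of_neg (sub_pos.2 h) (dissipation_neg hγ ha h)
  · have := dissipation_neg hγ hρ h
    rw [dissipation_symm] at this
    exact mul_neg_of_neg_of_pos (sub_neg.2 h) (by linarith)

/-! ### Entropic discontinuities -/

theorem entropy_eq (γ : ℝ) {u : State} {v : ℝ} (hu : 0 < u 0) (h : u 1 = u 0 * v) :
    entropy γ u = u 0 * v ^ 2 / 2 + u 0 * u 0 ^ (γ - 1) / (γ - 1) := by
  rw [entropy, h, ← pressure_eq hu γ]
  field_simp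

theorem entropyFlux_eq (γ : ℝ) {u : State} {v : ℝ} (hu : 0 < u 0) (h : u 1 = u 0 * v) :
    entropyFlux γ u = v * (u 0 * v ^ 2 / 2 + γ / (γ - 1) * (u 0 * u 0 ^ (γ - 1))) := by
  rw [entropyFlux, h]
  generalize u 0 ^ (γ - 1) = X
  field_simp

theorem momentum_balance_iff {a ρ s σ p : ℝ} (ha : 0 < a) (hρ : 0 < ρ) (hne : a ≠ ρ) :
    (ρ * σ + a * s) ^ 2 / ρ - (a * (σ + s)) ^ 2 / a + p = σ * ((ρ * σ + a * s) - a * (σ + s)) ↔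
      s ^ 2 = ρ / a * (p / (ρ - a)) := by
  have h : ρ - a ≠ 0 := sub_ne_zero.2 hne.symm
  have e : (ρ * σ + a * s) ^ 2 / ρ - (a * (σ + s)) ^ 2 / a + p -
      σ * ((ρ * σ + a * s) - a * (σ + s)) =
      -(a * (ρ - a) / ρ) * (s ^ 2 - ρ / a * (p / (ρ - a))) := by
    field_simp
    ring
  have h2 : -(a * (ρ - a) / ρ) ≠ 0 :=
    neg_ne_zero.2 (div_ne_zero (mul_ne_zero ha.ne' h) hρ.ne')
  rw [← sub_eq_zero, e, mul_eq_zero, or_iff_right h2, sub_eq_zero]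

theorem entropy_balance (hγ : 1 < γ) {uL uR : State} {σ s : ℝ} (hL : 0 < uL 0) (hR : 0 < uR 0)
    (hne : uL 0 ≠ uR 0) (h1 : uL 1 = uL 0 * (σ + s)) (h2 : uR 1 = uR 0 * σ + uL 0 * s)
    (hs : s ^ 2 = massFluxSq γ (uL 0) (uR 0)) :
    entropyFlux γ uR - entropyFlux γ uL - σ * (entropy γ uR - entropy γ uL) =
      uL 0 * s * dissipation γ (uL 0) (uR 0) := by
  have hγ1 : γ - 1 ≠ 0 := by linarith
  -- `w` is the velocity behind the jump relative to its speed, and `hw` is conservation of mass;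
  -- `hRH` below is the momentum balance written with that mass flux.
  obtain ⟨w, hw⟩ : ∃ w, uR 0 * w = uL 0 * s := ⟨uL 0 * s / uR 0, by field_simp⟩
  have h2' : uR 1 = uR 0 * (σ + w) := by rw [h2, mul_add, hw]
  have hRH : uL 0 * s * (s - w) =
      uR 0 * uR 0 ^ (γ - 1) - uL 0 * uL 0 ^ (γ - 1) := by
    have hne' : uR 0 - uL 0 ≠ 0 := sub_ne_zero.2 hne.symm
    have hw' : w = uL 0 * s / uR 0 := by
      rw [← hw]
      field_simp
    rw [← pressure_eq hL γ, ← pressure_eq hR γ]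
    have : uL 0 * s * (s - w) = uL 0 * (uR 0 - uL 0) / uR 0 * s ^ 2 := by
      rw [hw']
      field_simp
    rw [this, hs, massFluxSq]
    field_simp
  have hsum : uL 0 * s * (1 / uR 0 + 1 / uL 0) = w + s := by
    rw [mul_add, ← hw]
    nth_rewrite 2 [hw]
    field_simp
  have hdis : uL 0 * s * dissipation γ (uL 0) (uR 0) =
      uL 0 * s * (γ / (γ - 1) * (uR 0 ^ (γ - 1) - uL 0 ^ (γ - 1))) -
        (uR 0 * uR 0 ^ (γ - 1) - uL 0 * uL 0 ^ (γ - 1)) * (w + s) / 2 := by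
    rw [← hsum, dissipation, pressure_eq hL γ, pressure_eq hR γ]
    ring
  have hk : γ / (γ - 1) = 1 / (γ - 1) + 1 := by
    field_simp
    ring
  rw [hdis, entropy_eq γ hR h2', entropy_eq γ hL h1, entropyFlux_eq γ hR h2',
    entropyFlux_eq γ hL h1, hk]
  generalize uR 0 ^ (γ - 1) = P at *
  generalize uL 0 ^ (γ - 1) = Q at *
  linear_combination ((σ + w) ^ 2 / 2 + (1 / (γ - 1) + 1) * P) * hw - (σ + (w + s) / 2) * hRH

/-- Entropic discontinuities between states away from the vacuum. -/
theorem isEntropicDisc_iff (hγ : 1 < γ) {uL uR : State} {σ : ℝ} (hL : 0 < uL 0) (hR : 0 < uR 0) :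
    ConsLaw.IsEntropicDisc (flux γ) (entropy γ) (entropyFlux γ) uL uR σ ↔
      uL 0 ≠ uR 0 ∧ uR 1 = uL 1 + (uR 0 - uL 0) * σ ∧
        (uL 1 / uL 0 - σ) ^ 2 = massFluxSq γ (uL 0) (uR 0) ∧
        0 < (uL 1 / uL 0 - σ) * (uR 0 - uL 0) := by
  obtain ⟨s, hs⟩ : ∃ s, uL 1 / uL 0 - σ = s := ⟨_, rfl⟩
  have h1 : uL 1 = uL 0 * (σ + s) := by
    rw [← hs]
    field_simp
    ring
  rw [hs]
  have hent : uL 0 ≠ uR 0 → uR 1 = uL 1 + (uR 0 - uL 0) * σ →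
      s ^ 2 = massFluxSq γ (uL 0) (uR 0) →
      (entropyFlux γ uR - entropyFlux γ uL ≤ σ * (entropy γ uR - entropy γ uL) ↔
        0 < s * (uR 0 - uL 0)) := by
    intro hne h2 hs2
    have hb := entropy_balance hγ hL hR hne h1 (by rw [h2, h1]; ring) hs2
    have hd := mul_dissipation_neg hγ hL hR hne
    have hs0 : 0 < s ^ 2 := hs2 ▸ massFluxSq_pos hγ hL hR hne
    rw [← sub_nonpos, hb, mul_assoc]
    have hprod : s * dissipation γ (uL 0) (uR 0) * (s * (uR 0 - uL 0)) < 0 := by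
      have := mul_neg_of_pos_of_neg hs0 hd
      linarith
    constructor
    · intro h
      by_contra! hle
      have h3 : s * dissipation γ (uL 0) (uR 0) ≤ 0 := nonpos_of_mul_nonpos_right h hL
      exact absurd (mul_nonneg_of_nonpos_of_nonpos h3 hle) (not_le.2 hprod)
    · intro h
      exact mul_nonpos_of_nonneg_of_nonpos hL.le (neg_of_mul_neg_left hprod h.le).le
  have hRH : flux γ uR - flux γ uL = σ • (uR - uL) ↔
      uR 1 = uL 1 + (uR 0 - uL 0) * σ ∧
      uR 1 ^ 2 / uR 0 - uL 1 ^ 2 / uL 0 + (uR 0 ^ γ - uL 0 ^ γ) = σ * (uR 1 - uL 1) := by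
    constructor
    · intro h
      have e0 := congrArg (fun x : State => x 0) h
      have e1 := congrArg (fun x : State => x 1) h
      simp [flux] at e0 e1
      exact ⟨by linarith, by linarith⟩
    · rintro ⟨e0, e1⟩
      apply state_ext
      · simp [flux]
        linarith
      · simp [flux]
        linarith
  constructor
  · rintro ⟨hj, hrh, he⟩
    obtain ⟨e0, e1⟩ := hRH.1 hrh
    have hne : uL 0 ≠ uR 0 := fun h => hj (state_ext h (by rw [e0, h]; ring))
    have h2 : uR 1 = uR 0 * σ + uL 0 * s := by rw [e0, h1]; ring
    have hs2 : s ^ 2 = massFluxSq γ (uL 0) (uR 0) := by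
      rw [h2, h1] at e1
      exact (momentum_balance_iff hL hR hne).1 e1
    exact ⟨hne, e0, hs2, (hent hne e0 hs2).1 he⟩
  · rintro ⟨hne, e0, hs2, he⟩
    have h2 : uR 1 = uR 0 * σ + uL 0 * s := by rw [e0, h1]; ring
    refine ⟨fun h => hne (by rw [h]), hRH.2 ⟨e0, ?_⟩, (hent hne e0 hs2).2 he⟩
    rw [h2, h1]
    exact (momentum_balance_iff hL hR hne).2 hs2

/-- A jump to the vacuum would move with the velocity of the gas, and the momentum balance would
then force zero pressure. -/
theorem flux_ne_smul (γ : ℝ) {u : State} (hu : 0 < u 0) (σ : ℝ) : flux γ u ≠ σ • u := by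
  intro h
  have e0 := congrArg (fun x : State => x 0) h
  have e1 := congrArg (fun x : State => x 1) h
  simp [flux] at e0 e1
  have := Real.rpow_pos_of_pos hu γ
  have h2 : (σ * u 0) ^ 2 / u 0 = σ * (σ * u 0) := by field_simp
  rw [e0, h2] at e1
  linarith

theorem flux_vacuum (hγ : 1 < γ) : flux γ 0 = 0 := by
  apply state_ext <;> simp [flux, Real.zero_rpow (by linarith : γ ≠ 0)]

/-- No discontinuity is connected to the vacuum. -/
theorem mem_region_left_of_isEntropicDisc (hγ : 1 < γ) (hC : 0 < C) {η q : State → ℝ}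
    {uL uR : State} {σ : ℝ} (hL : uL ∈ stateSet γ C) (hR : uR ∈ region γ C)
    (h : ConsLaw.IsEntropicDisc (flux γ) η q uL uR σ) : uL ∈ region γ C := by
  rw [stateSet_eq hγ hC] at hL
  rcases hL with rfl | hL
  · have := h.rankineHugoniot
    rw [flux_vacuum hγ, sub_zero, sub_zero] at this
    exact absurd this (flux_ne_smul γ hR.1 σ)
  · exact hL

theorem mem_region_right_of_isEntropicDisc (hγ : 1 < γ) (hC : 0 < C) {η q : State → ℝ}
    {uL uR : State} {σ : ℝ} (hL : uL ∈ region γ C) (hR : uR ∈ stateSet γ C)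
    (h : ConsLaw.IsEntropicDisc (flux γ) η q uL uR σ) : uR ∈ region γ C := by
  rw [stateSet_eq hγ hC] at hR
  rcases hR with rfl | hR
  · have := h.rankineHugoniot
    rw [flux_vacuum hγ, zero_sub, zero_sub, smul_neg, neg_inj] at this
    exact absurd this (flux_ne_smul γ hL.1 σ)
  · exact hR

/-! ### The 1-shock curve, parametrized by the jump of the density -/

/-- Speed of the 1-shock from `u` with density jump `t`. -/
noncomputable def shockSpeed (γ : ℝ) (u : State) (t : ℝ) : ℝ :=
  u 1 / u 0 - √(massFluxSq γ (u 0) (u 0 + t))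

/-- Right state of the 1-shock from `u` with density jump `t`. -/
noncomputable def shockCurve (γ : ℝ) (u : State) (t : ℝ) : State :=
  !₂[u 0 + t, u 1 + t * shockSpeed γ u t]

@[simp] theorem shockCurve_density (γ : ℝ) (u : State) (t : ℝ) :
    shockCurve γ u t 0 = u 0 + t := rfl

@[simp] theorem shockCurve_momentum (γ : ℝ) (u : State) (t : ℝ) :
    shockCurve γ u t 1 = u 1 + t * shockSpeed γ u t := rfl

theorem shockCurve_zero (γ : ℝ) (u : State) : shockCurve γ u 0 = u := by
  apply state_ext <;> simp

/-- This form is visibly continuous at `t = 0`, where `shockSpeed` takes a default value different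
from its limit. -/
theorem shockCurve_momentum_eq (hγ : 1 < γ) {u : State} {t : ℝ} (hu : 0 < u 0) (ht : 0 ≤ t) :
    shockCurve γ u t 1 = (u 0 + t) * (u 1 / u 0 - velocityJump γ (u 0) (u 0 + t)) := by
  have h := mul_sqrt_massFluxSq hγ hu (le_add_of_nonneg_right ht)
  rw [mul_sub, ← h, shockCurve_momentum, shockSpeed]
  field_simp
  ring

theorem shockCurve_velocity (hγ : 1 < γ) {u : State} {t : ℝ} (hu : 0 < u 0) (ht : 0 ≤ t) :
    shockCurve γ u t 1 / shockCurve γ u t 0 =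
      u 1 / u 0 - velocityJump γ (u 0) (u 0 + t) := by
  have : u 0 + t ≠ 0 := by positivity
  rw [shockCurve_momentum_eq hγ hu ht, shockCurve_density]
  field_simp

theorem isEntropicDisc_shockCurve (hγ : 1 < γ) {u : State} {t : ℝ} (hu : 0 < u 0) (ht : 0 < t) :
    ConsLaw.IsEntropicDisc (flux γ) (entropy γ) (entropyFlux γ) u (shockCurve γ u t)
      (shockSpeed γ u t) := by
  have hA := massFluxSq_pos hγ hu (by positivity : 0 < u 0 + t) (by linarith)
  have h0 : 0 < u 0 + t := by positivity
  rw [isEntropicDisc_iff hγ hu (by simpa using h0)]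
  have e : u 1 / u 0 - shockSpeed γ u t = √(massFluxSq γ (u 0) (u 0 + t)) := by
    simp [shockSpeed]
  refine ⟨by simpa using ht.ne', by simp, ?_, ?_⟩
  · rw [e, Real.sq_sqrt hA.le]
    rfl
  · rw [e]
    have := Real.sqrt_pos.2 hA
    simpa using mul_pos this ht

/-- The velocity behind a discontinuity relative to its speed. -/
theorem relative_speed_right {uL uR : State} {σ : ℝ} (hL : 0 < uL 0) (hR : 0 < uR 0)
    (h2 : uR 1 = uL 1 + (uR 0 - uL 0) * σ)
    (hs : (uL 1 / uL 0 - σ) ^ 2 = massFluxSq γ (uL 0) (uR 0)) :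
    uR 1 / uR 0 - σ = uL 0 / uR 0 * (uL 1 / uL 0 - σ) ∧
      (uR 1 / uR 0 - σ) ^ 2 = massFluxSq γ (uR 0) (uL 0) := by
  have e : uR 1 / uR 0 - σ = uL 0 / uR 0 * (uL 1 / uL 0 - σ) := by
    rw [h2]
    field_simp
    ring
  refine ⟨e, ?_⟩
  rw [e, mul_pow, hs, massFluxSq_symm γ hL hR]

theorem soundSpeed_sq (hγ : 1 < γ) {ρ : ℝ} (hρ : 0 < ρ) :
    (√γ * ρ ^ ((γ - 1) / 2)) ^ 2 = γ * ρ ^ (γ - 1) := by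
  rw [mul_pow, sound_sq hρ.le, Real.sq_sqrt (by linarith)]

theorem soundSpeed_pos (hγ : 1 < γ) {ρ : ℝ} (hρ : 0 < ρ) : 0 < √γ * ρ ^ ((γ - 1) / 2) :=
  mul_pos (Real.sqrt_pos.2 (by linarith)) (Real.rpow_pos_of_pos hρ _)

/-- An entropic discontinuity travels faster than the first characteristic speed behind it. -/
theorem charSpeed_lt_of_isEntropicDisc (hγ : 1 < γ) {uL uR : State} {σ : ℝ} (hL : 0 < uL 0)
    (hR : 0 < uR 0)
    (h : ConsLaw.IsEntropicDisc (flux γ) (entropy γ) (entropyFlux γ) uL uR σ) :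
    charSpeed γ (-1) uR < σ := by
  obtain ⟨hne, h2, hs, he⟩ := (isEntropicDisc_iff hγ hL hR).1 h
  obtain ⟨e, hs'⟩ := relative_speed_right hL hR h2 hs
  have hc := soundSpeed_pos hγ hR
  have hc2 := soundSpeed_sq hγ hR
  simp only [charSpeed]
  rcases lt_or_gt_of_ne hne with hlt | hgt
  · have hlt' := massFluxSq_lt_soundSpeed hγ hL hlt
    rw [← hs', ← hc2] at hlt'
    have := lt_of_pow_lt_pow_left₀ 2 hc.le hlt'
    linarith
  · have hs0 : uL 1 / uL 0 - σ < 0 := by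
      by_contra! h0
      exact absurd (mul_nonpos_of_nonneg_of_nonpos h0 (sub_neg.2 hgt).le) (not_le.2 he)
    have := mul_neg_of_pos_of_neg (div_pos hL hR) hs0
    linarith

theorem isOneShock_shockCurve (hγ : 1 < γ) {u : State} {t : ℝ} (hu : 0 < u 0) (ht : 0 < t) :
    ConsLaw.IsOneShock (flux γ) (entropy γ) (entropyFlux γ) (charSpeed γ (-1)) (charSpeed γ 1) u
      (shockCurve γ u t) (shockSpeed γ u t) := by
  have hd := isEntropicDisc_shockCurve hγ hu ht
  have hR : 0 < shockCurve γ u t 0 := by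
    simp only [shockCurve_density]
    positivity
  have hlt : u 0 < u 0 + t := by linarith
  have hA := massFluxSq_pos hγ hu (by positivity : 0 < u 0 + t) hlt.ne
  refine ⟨hd, ?_, charSpeed_lt_of_isEntropicDisc hγ hu hR hd, ?_⟩
  · have h1 := soundSpeed_lt_massFluxSq hγ hu hlt
    rw [← soundSpeed_sq hγ hu] at h1
    have := (Real.lt_sqrt (soundSpeed_pos hγ hu).le).2 h1
    simp only [shockSpeed, charSpeed]
    linarith
  · obtain ⟨hne, h2, hs, he⟩ := (isEntropicDisc_iff hγ hu hR).1 hd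
    obtain ⟨e, -⟩ := relative_speed_right hu hR h2 hs
    have h3 : 0 < u 1 / u 0 - shockSpeed γ u t := by
      have := Real.sqrt_pos.2 hA
      simpa [shockSpeed] using this
    have h4 := mul_pos (div_pos hu hR) h3
    have h5 := soundSpeed_pos hγ hR
    simp only [charSpeed]
    linarith

/-- Slow entropic discontinuities lie on the 1-shock curve. -/
theorem eq_shockCurve_of_isEntropicDisc (hγ : 1 < γ) {uL uR : State} {σ : ℝ} (hL : 0 < uL 0)
    (hR : 0 < uR 0) (h : ConsLaw.IsEntropicDisc (flux γ) (entropy γ) (entropyFlux γ) uL uR σ)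
    (hσ : σ ≤ charSpeed γ (-1) uL) :
    ∃ t > 0, uR = shockCurve γ uL t ∧ σ = shockSpeed γ uL t := by
  obtain ⟨hne, h2, hs, he⟩ := (isEntropicDisc_iff hγ hL hR).1 h
  have hc := soundSpeed_pos hγ hL
  simp only [charSpeed] at hσ
  have hs0 : 0 < uL 1 / uL 0 - σ := by linarith
  have hτ : 0 < uR 0 - uL 0 := pos_of_mul_pos_right he hs0.le
  have e0 : uL 0 + (uR 0 - uL 0) = uR 0 := by ring
  have hσ' : σ = shockSpeed γ uL (uR 0 - uL 0) := by
    rw [shockSpeed, e0, ← hs, Real.sqrt_sq hs0.le]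
    ring
  refine ⟨uR 0 - uL 0, hτ, state_ext (by simp) ?_, hσ'⟩
  rw [shockCurve_momentum, ← hσ', h2]

theorem shockCurve_mem_region_iff (hγ : 1 < γ) {u : State} {t : ℝ} (hu : 0 < u 0) (ht : 0 ≤ t) :
    shockCurve γ u t ∈ region γ C ↔
      -C < w₁ γ (u 0 + t) (u 1 / u 0 - velocityJump γ (u 0) (u 0 + t)) ∧
        w₂ γ (u 0 + t) (u 1 / u 0 - velocityJump γ (u 0) (u 0 + t)) < C := by
  have h0 : 0 < u 0 + t := by positivity
  simp only [region, mem_ofPred_eq]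
  rw [shockCurve_velocity hγ hu ht, shockCurve_density]
  exact and_iff_right h0

/-- The 1-shock curve leaves the region once and for all. -/
theorem exists_exit (hγ : 1 < γ) (hC : 0 < C) {u : State} (hu : u ∈ region γ C) :
    ∃ T > 0, (∀ t ∈ Ico 0 T, shockCurve γ u t ∈ region γ C) ∧
      ∀ t, T ≤ t → shockCurve γ u t ∉ region γ C := by
  obtain ⟨h0, h1, h2⟩ := hu
  set F : ℝ → ℝ := fun t => velocityJump γ (u 0) (u 0 + t) +
    2 * √γ / (γ - 1) * (u 0 + t) ^ ((γ - 1) / 2) with hF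
  have hmaps : MapsTo (fun t : ℝ => u 0 + t) (Ici 0) (Ici (u 0)) := fun t ht =>
    mem_Ici.2 (le_add_of_nonneg_right ht)
  have hFc : ContinuousOn F (Ici 0) :=
    ((continuousOn_velocityJump γ h0).add (continuousOn_riemann γ h0)).comp
      (by fun_prop) hmaps
  have hFm : StrictMonoOn F (Ici 0) := fun x hx y hy hxy =>
    strictMonoOn_velocityJump_add hγ h0 (hmaps hx) (hmaps hy) (by linarith)
  have hF0 : F 0 < u 1 / u 0 + C := by
    simp only [hF, add_zero, velocityJump_self, zero_add]
    simp only [w₁] at h1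
    linarith
  -- The bound `2 * C` suffices because `v < C`: once the sound term reaches `2 * C`, it exceeds `v
  -- + C`.
  obtain ⟨M, hM, hb⟩ := exists_density_bound hγ (by linarith : 0 < 2 * C)
  have hFM : u 1 / u 0 + C ≤ F M := by
    have h3 : 2 * C ≤ 2 * √γ / (γ - 1) * (u 0 + M) ^ ((γ - 1) / 2) := by
      by_contra! h
      have := hb (u 0 + M) (by positivity) h
      linarith
    have h4 := velocityJump_nonneg γ (u 0) (u 0 + M)
    have h5 : u 1 / u 0 < C := by
      have := mul_pos (riemannCoeff_pos hγ) (Real.rpow_pos_of_pos h0 ((γ - 1) / 2))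
      simp only [w₂] at h2
      linarith
    simp only [hF]
    linarith
  -- `F t = v + C` means that `w₁ = -C` at parameter `t`.
  obtain ⟨T, hT, hFT⟩ := intermediate_value_Icc hM.le (hFc.mono Icc_subset_Ici_self)
    (⟨hF0.le, hFM⟩ : u 1 / u 0 + C ∈ Icc (F 0) (F M))
  have hT0 : 0 < T := by
    rcases hT.1.eq_or_lt with h | h
    · rw [← h] at hFT
      exact absurd hFT hF0.ne
    · exact h
  refine ⟨T, hT0, fun t ht => ?_, fun t ht hmem => ?_⟩
  · rw [shockCurve_mem_region_iff hγ h0 ht.1]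
    have h3 := hFm (mem_Ici.2 ht.1) (mem_Ici.2 hT0.le) ht.2
    have h4 := monotoneOn_velocityJump_sub hγ h0 (mem_Ici.2 le_rfl)
      (hmaps (mem_Ici.2 ht.1)) (hmaps (mem_Ici.2 ht.1))
    simp only [velocityJump_self] at h4
    simp only [hFT] at h3
    simp only [hF] at h3
    simp only [w₁, w₂] at h1 h2 ⊢
    constructor <;> linarith
  · have ht0 : 0 ≤ t := hT0.le.trans ht
    rw [shockCurve_mem_region_iff hγ h0 ht0] at hmem
    have h3 := hFm.monotoneOn (mem_Ici.2 hT0.le) (mem_Ici.2 ht0) ht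
    rw [hFT] at h3
    simp only [hF] at h3
    have h4 := hmem.1
    simp only [w₁] at h4
    linarith

theorem continuousOn_shockCurve (hγ : 1 < γ) {u : State} (hu : 0 < u 0) :
    ContinuousOn (shockCurve γ u) (Ici 0) := by
  have hmaps : MapsTo (fun t : ℝ => u 0 + t) (Ici 0) (Ici (u 0)) := fun t ht =>
    mem_Ici.2 (le_add_of_nonneg_right ht)
  have h1 : ContinuousOn (fun t => velocityJump γ (u 0) (u 0 + t)) (Ici 0) :=
    (continuousOn_velocityJump γ hu).comp (by fun_prop) hmaps
  have h2 : ContinuousOn (fun t => (!₂[u 0 + t,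
      (u 0 + t) * (u 1 / u 0 - velocityJump γ (u 0) (u 0 + t))] : State)) (Ici 0) := by
    fun_prop
  refine h2.congr fun t ht => state_ext rfl ?_
  rw [shockCurve_momentum_eq hγ hu ht]
  rfl

theorem contDiffAt_shockSpeed {n : WithTop ℕ∞} (hγ : 1 < γ) {u : State} {t : ℝ} (hu : 0 < u 0)
    (ht : 0 < t) : ContDiffAt ℝ n (shockSpeed γ u) t := by
  have h0 : 0 < u 0 + t := by positivity
  have hA := massFluxSq_pos hγ hu h0 (by linarith)
  have hid : ContDiffAt ℝ n (fun t : ℝ => u 0 + t) t := by fun_prop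
  have h1 : ContDiffAt ℝ n (fun t : ℝ => (u 0 + t) ^ γ) t := hid.rpow_const_of_ne h0.ne'
  have h2 : ContDiffAt ℝ n (fun t : ℝ => massFluxSq γ (u 0) (u 0 + t)) t := by
    refine (hid.div_const _).mul (ContDiffAt.div (h1.sub contDiffAt_const)
      (hid.sub contDiffAt_const) ?_)
    simpa using ht.ne'
  exact contDiffAt_const.sub (h2.sqrt hA.ne')

theorem contDiffAt_shockCurve {n : WithTop ℕ∞} (hγ : 1 < γ) {u : State} {t : ℝ} (hu : 0 < u 0)
    (ht : 0 < t) : ContDiffAt ℝ n (shockCurve γ u) t := by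
  refine contDiffAt_euclidean.2 fun i => ?_
  fin_cases i
  · change ContDiffAt ℝ n (fun t : ℝ => u 0 + t) t
    fun_prop
  · exact contDiffAt_const.add (contDiffAt_id.mul (contDiffAt_shockSpeed hγ hu ht))

theorem hasDerivAt_shockSpeed (hγ : 1 < γ) {u : State} {t : ℝ} (hu : 0 < u 0) (ht : 0 < t) :
    HasDerivAt (shockSpeed γ u) (-(massFluxSqDeriv γ (u 0) (u 0 + t) /
      (2 * √(massFluxSq γ (u 0) (u 0 + t))))) t := by
  have h0 : 0 < u 0 + t := by positivity
  have hA := massFluxSq_pos hγ hu h0 (by linarith)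
  have h := (hasDerivAt_massFluxSq γ hu (by linarith : u 0 < u 0 + t)).comp_const_add (u 0) t
  exact (h.sqrt hA.ne').const_sub (u 1 / u 0)

theorem hasDerivAt_shockSpeed_neg (hγ : 1 < γ) {u : State} {t : ℝ} (hu : 0 < u 0) (ht : 0 < t) :
    ∃ d < 0, HasDerivAt (shockSpeed γ u) d t := by
  refine ⟨_, ?_, hasDerivAt_shockSpeed hγ hu ht⟩
  have hA := massFluxSq_pos hγ hu (by positivity : 0 < u 0 + t) (by linarith)
  have := Real.sqrt_pos.2 hA
  have := massFluxSqDeriv_pos hγ hu (by linarith : u 0 < u 0 + t)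
  exact neg_neg_of_pos (by positivity)

/-! ### Strength and relative entropy along the 1-shock curve -/

theorem norm_sub_shockCurve (γ : ℝ) (u : State) {t : ℝ} (ht : 0 ≤ t) :
    ‖u - shockCurve γ u t‖ = t * √(1 + shockSpeed γ u t ^ 2) := by
  rw [EuclideanSpace.norm_eq, Fin.sum_univ_two]
  simp only [PiLp.sub_apply, shockCurve_density, shockCurve_momentum, Real.norm_eq_abs, sq_abs]
  rw [show (u 0 - (u 0 + t)) ^ 2 + (u 1 - (u 1 + t * shockSpeed γ u t)) ^ 2 =
    t ^ 2 * (1 + shockSpeed γ u t ^ 2) by ring, Real.sqrt_mul (sq_nonneg t), Real.sqrt_sq ht]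

theorem le_norm_sub_shockCurve (γ : ℝ) (u : State) {t : ℝ} (ht : 0 ≤ t) :
    t ≤ ‖u - shockCurve γ u t‖ := by
  rw [norm_sub_shockCurve γ u ht]
  exact le_mul_of_one_le_right ht (Real.one_le_sqrt.2 (by nlinarith [sq_nonneg (shockSpeed γ u t)]))

/-- The strength is `t √(1 + σ²)`, whose derivative has the sign of `1 + σ² + σ (t σ')`. Completing
the square, this is positive as soon as `|t σ'| < 2`; the hypothesis ensures `|t σ'| < 1`. -/
theorem deriv_strength_pos (hγ : 1 < γ) {u : State} {t : ℝ} (hu : 0 < u 0) (ht : 0 < t)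
    (hsmall : (t / u 0 * (γ * (u 0 + t) ^ (γ - 1)) +
      (u 0 + t) / u 0 * (γ * (u 0 + t) ^ (γ - 1) - γ * u 0 ^ (γ - 1))) ^ 2 <
        γ * u 0 ^ (γ - 1)) :
    0 < deriv (fun t => ‖u - shockCurve γ u t‖) t := by
  have h0 : 0 < u 0 + t := by positivity
  have hlt : u 0 < u 0 + t := by linarith
  have hA := massFluxSq_pos hγ hu h0 hlt.ne
  have hd := hasDerivAt_shockSpeed hγ hu ht
  set d := -(massFluxSqDeriv γ (u 0) (u 0 + t) / (2 * √(massFluxSq γ (u 0) (u 0 + t)))) with hdd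
  have hsq : 0 < 1 + shockSpeed γ u t ^ 2 := by positivity
  have h := (hasDerivAt_id t).fun_mul (((hd.fun_pow 2).const_add 1).sqrt hsq.ne')
  have h' := h.congr_of_eventuallyEq (f₁ := fun t => ‖u - shockCurve γ u t‖) (by
    filter_upwards [Ioi_mem_nhds ht] with y hy using norm_sub_shockCurve γ u (le_of_lt hy))
  rw [h'.deriv]
  have hy : (t * d) ^ 2 < 1 := by
    have h1 := mul_massFluxSqDeriv_le hγ hu hlt
    rw [add_sub_cancel_left] at h1
    have h2 : 0 < t * massFluxSqDeriv γ (u 0) (u 0 + t) :=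
      mul_pos ht (massFluxSqDeriv_pos hγ hu hlt)
    have h3 : (t * massFluxSqDeriv γ (u 0) (u 0 + t)) ^ 2 < massFluxSq γ (u 0) (u 0 + t) :=
      ((pow_le_pow_left₀ h2.le h1 2).trans_lt hsmall).trans (soundSpeed_lt_massFluxSq hγ hu hlt)
    have e : (t * d) ^ 2 = (t * massFluxSqDeriv γ (u 0) (u 0 + t)) ^ 2 /
        (4 * massFluxSq γ (u 0) (u 0 + t)) := by
      rw [hdd, mul_pow, neg_sq, div_pow, mul_pow 2, Real.sq_sqrt hA.le]
      ring
    rw [e, div_lt_one (by positivity)]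
    linarith
  have hr := Real.sqrt_pos.2 hsq
  have hr2 := Real.sq_sqrt hsq.le
  have e : 1 * √(1 + shockSpeed γ u t ^ 2) + id t * ((2 : ℕ) * shockSpeed γ u t ^ (2 - 1) * d /
      (2 * √(1 + shockSpeed γ u t ^ 2))) =
      (1 + shockSpeed γ u t ^ 2 + shockSpeed γ u t * (t * d)) /
        √(1 + shockSpeed γ u t ^ 2) := by
    rw [eq_div_iff hr.ne', add_mul, one_mul, ← sq, hr2]
    simp
    field_simp
  rw [e]
  refine div_pos ?_ hr
  nlinarith [sq_nonneg (shockSpeed γ u t + t * d / 2)]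

/-- The smallness condition is a strict inequality between functions of `(u, t)` continuous at `(d,
0)`, and its left side vanishes there; this gives uniformity in `u`. -/
theorem strength_increasing_locally (hγ : 1 < γ) {d : State} (hd : 0 < d 0) :
    ∃ ε > 0, ∀ u ∈ Metric.ball d ε, 0 < u 0 → ∀ t > 0, t < ε →
      0 < deriv (fun t => ‖u - shockCurve γ u t‖) t := by
  have hc0 : ContinuousAt (fun p : State × ℝ => p.1 0) (d, 0) := by fun_prop
  have hct : ContinuousAt (fun p : State × ℝ => p.2) (d, 0) := by fun_prop
  have hcs : ContinuousAt (fun p : State × ℝ => p.1 0 + p.2) (d, 0) := by fun_prop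
  have hr0 : ContinuousAt (fun p : State × ℝ => γ * p.1 0 ^ (γ - 1)) (d, 0) :=
    continuousAt_const.mul (hc0.rpow_const (Or.inl hd.ne'))
  have hrs : ContinuousAt (fun p : State × ℝ => γ * (p.1 0 + p.2) ^ (γ - 1)) (d, 0) :=
    continuousAt_const.mul (hcs.rpow_const (Or.inl (by simpa using hd.ne')))
  have hF : ContinuousAt (fun p : State × ℝ => (p.2 / p.1 0 * (γ * (p.1 0 + p.2) ^ (γ - 1)) +
      (p.1 0 + p.2) / p.1 0 * (γ * (p.1 0 + p.2) ^ (γ - 1) - γ * p.1 0 ^ (γ - 1))) ^ 2) (d, 0) :=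
    (((hct.div hc0 hd.ne').mul hrs).add ((hcs.div hc0 hd.ne').mul (hrs.sub hr0))).pow 2
  have hev := hF.eventually_lt hr0 (by
    have : 0 < γ * d 0 ^ (γ - 1) := mul_pos (by linarith) (Real.rpow_pos_of_pos hd _)
    simpa using this)
  obtain ⟨ε, hε, h⟩ := Metric.eventually_nhds_iff.1 hev
  refine ⟨ε, hε, fun u hu hu0 t ht htε => deriv_strength_pos hγ hu0 ht (h (y := (u, t)) ?_)⟩
  rw [Prod.dist_eq]
  refine max_lt hu ?_
  rwa [Real.dist_eq, sub_zero, abs_of_pos ht]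

theorem relEntropy_eq (hγ : 1 < γ) {x b : State} (hx : 0 < x 0) (hb : 0 < b 0) :
    ConsLaw.relEntropy (entropy γ) x b = x 0 * (x 1 / x 0 - b 1 / b 0) ^ 2 / 2 +
      (x 0 ^ γ - b 0 ^ γ) / (γ - 1) - γ / (γ - 1) * b 0 ^ (γ - 1) * (x 0 - b 0) := by
  rw [ConsLaw.relEntropy, fderiv_entropy hγ _ hb, entropy, entropy]
  simp only [PiLp.sub_apply]
  generalize b 0 ^ (γ - 1) = X
  have hγ1 : γ - 1 ≠ 0 := by linarith
  field_simp
  ring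

/-- Eliminating the velocity by the jump relation leaves a function of the density alone, whose
derivative is a sum of positive terms. -/
theorem hasDerivAt_relEntropy_shockCurve (hγ : 1 < γ) {u : State} {t : ℝ} (hu : 0 < u 0)
    (ht : 0 < t) :
    ∃ c > 0, HasDerivAt (fun t => ConsLaw.relEntropy (entropy γ) u (shockCurve γ u t)) c t := by
  have hγ1 : γ - 1 ≠ 0 := by linarith
  have h0 : 0 < u 0 + t := by positivity
  have hlt : u 0 < u 0 + t := by linarith
  set E : ℝ → ℝ := fun ρ => u 0 * ((1 / u 0 - ρ⁻¹) * (ρ ^ γ - u 0 ^ γ)) / 2 +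
    (u 0 ^ γ - ρ ^ γ) / (γ - 1) - γ / (γ - 1) * ρ ^ (γ - 1) * (u 0 - ρ) with hE
  have hEq : ∀ s > 0,
      ConsLaw.relEntropy (entropy γ) u (shockCurve γ u s) = E (u 0 + s) := by
    intro s hs
    have h0 : 0 < u 0 + s := by positivity
    rw [relEntropy_eq hγ hu (by simpa using h0), shockCurve_velocity hγ hu (le_of_lt hs),
      sub_sub_cancel, velocityJump, Real.sq_sqrt (velocityJump_sq_pos hγ hu (by linarith)).le]
    simp [hE]
  have hp := hasDerivAt_pressure γ h0
  have hd := (((((hasDerivAt_inv h0.ne').const_sub (1 / u 0)).fun_mul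
    (hp.sub_const (u 0 ^ γ))).const_mul (u 0)).div_const 2).fun_add
      ((hp.const_sub (u 0 ^ γ)).div_const (γ - 1))
  have hd' := hd.fun_sub (((hasDerivAt_pressure (γ - 1) h0).const_mul (γ / (γ - 1))).fun_mul
    ((hasDerivAt_id (u 0 + t)).const_sub (u 0)))
  have hd'' : HasDerivAt E (u 0 * (((u 0 + t) ^ γ - u 0 ^ γ) / (u 0 + t) ^ 2 +
      (1 / u 0 - 1 / (u 0 + t)) * (γ * (u 0 + t) ^ (γ - 1))) / 2 +
      γ * (u 0 + t) ^ (γ - 1 - 1) * t) (u 0 + t) := by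
    refine hd'.congr_deriv ?_
    simp only [id]
    generalize (u 0 + t) ^ (γ - 1 - 1) = X
    generalize (u 0 + t) ^ (γ - 1) = Y
    field_simp
    ring
  refine ⟨_, ?_, (hd''.comp_const_add (u 0) t).congr_of_eventuallyEq (by
    filter_upwards [Ioi_mem_nhds ht] with y hy using hEq y hy)⟩
  have h1 : 0 < (u 0 + t) ^ γ - u 0 ^ γ :=
    sub_pos.2 (Real.rpow_lt_rpow hu.le hlt (by linarith))
  have h2 : 0 < 1 / u 0 - 1 / (u 0 + t) := sub_pos.2 (one_div_lt_one_div_of_lt hu hlt)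
  have h3 : 0 < γ := by linarith
  positivity

/-! ### Reflection of the second family onto the first -/

/-- The reflection `v ↦ -v`, which interchanges the two families. -/
noncomputable def reflect : State ≃ₗᵢ[ℝ] State where
  toFun u := !₂[u 0, -u 1]
  invFun u := !₂[u 0, -u 1]
  map_add' x y := by
    apply state_ext <;> simp
    ring
  map_smul' c x := by apply state_ext <;> simp
  left_inv x := by apply state_ext <;> simp
  right_inv x := by apply state_ext <;> simp
  norm_map' x := by simp [EuclideanSpace.norm_eq]

@[simp] theorem reflect_density (u : State) : reflect u 0 = u 0 := rfl

@[simp] theorem reflect_momentum (u : State) : reflect u 1 = -u 1 := rfl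

@[simp] theorem reflect_reflect (u : State) : reflect (reflect u) = u := by
  apply state_ext <;> simp

theorem reflect_mem_region {u : State} (hu : u ∈ region γ C) : reflect u ∈ region γ C := by
  rw [mem_region_iff] at *
  simp only [reflect_density, reflect_momentum]
  exact ⟨hu.1, by linarith [hu.2.2], by linarith [hu.2.1]⟩

theorem reflect_mem_stateSet (hγ : 1 < γ) (hC : 0 < C) {u : State} (hu : u ∈ stateSet γ C) :
    reflect u ∈ stateSet γ C := by
  rw [stateSet_eq hγ hC] at *
  rcases hu with rfl | hu
  · left
    exact map_zero reflect
  · exact Or.inr (reflect_mem_region hu)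

theorem flux_reflect (γ : ℝ) (u : State) : flux γ (reflect u) = -reflect (flux γ u) := by
  apply state_ext <;> simp [flux]

theorem entropy_reflect (γ : ℝ) (u : State) : entropy γ (reflect u) = entropy γ u := by
  simp [entropy]

theorem entropyFlux_reflect (γ : ℝ) (u : State) :
    entropyFlux γ (reflect u) = -entropyFlux γ u := by
  simp only [entropyFlux, reflect_density, reflect_momentum]
  ring

theorem charSpeed_reflect (γ ε : ℝ) (u : State) :
    charSpeed γ ε (reflect u) = -charSpeed γ (-ε) u := by
  simp only [charSpeed, reflect_density, reflect_momentum]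
  ring

/-- The chain rule for a linear equivalence needs no differentiability, so positive density is not
required. -/
theorem relEntropy_reflect (γ : ℝ) (x b : State) :
    ConsLaw.relEntropy (entropy γ) (reflect x) (reflect b) =
      ConsLaw.relEntropy (entropy γ) x b := by
  have h : entropy γ ∘ reflect = entropy γ := funext (entropy_reflect γ)
  have h2 := reflect.toContinuousLinearEquiv.comp_right_fderiv (f := entropy γ) (x := b)
  have h3 : fderiv ℝ (entropy γ) b (x - b) =
      fderiv ℝ (entropy γ) (reflect b) (reflect (x - b)) := by
    have h4 : entropy γ ∘ reflect.toContinuousLinearEquiv = entropy γ := h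
    rw [h4] at h2
    rw [h2]
    rfl
  rw [ConsLaw.relEntropy, ConsLaw.relEntropy, entropy_reflect, entropy_reflect, h3, map_sub reflect]

theorem isEntropicDisc_reflect {uL uR : State} {σ : ℝ}
    (h : ConsLaw.IsEntropicDisc (flux γ) (entropy γ) (entropyFlux γ) uL uR σ) :
    ConsLaw.IsEntropicDisc (flux γ) (entropy γ) (entropyFlux γ) (reflect uR) (reflect uL)
      (-σ) := by
  refine ⟨fun e => h.jump (reflect.injective e.symm), ?_, ?_⟩
  · have := congrArg reflect h.rankineHugoniot
    rw [map_sub, map_smul, map_sub] at this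
    rw [flux_reflect, flux_reflect, neg_sub_neg, this, neg_smul, ← smul_neg, neg_sub]
  · have := h.entropic
    rw [entropyFlux_reflect, entropyFlux_reflect, entropy_reflect, entropy_reflect]
    linarith

theorem isTwoShock_reflect {uL uR : State} {σ : ℝ}
    (h : ConsLaw.IsOneShock (flux γ) (entropy γ) (entropyFlux γ) (charSpeed γ (-1))
      (charSpeed γ 1) uL uR σ) :
    ConsLaw.IsTwoShock (flux γ) (entropy γ) (entropyFlux γ) (charSpeed γ (-1))
      (charSpeed γ 1) (reflect uR) (reflect uL) (-σ) := by
  refine ⟨isEntropicDisc_reflect h.disc, ?_, ?_, ?_⟩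
  · rw [charSpeed_reflect]
    exact neg_lt_neg h.lax_right
  · rw [charSpeed_reflect]
    exact neg_lt_neg h.lax_left
  · rw [charSpeed_reflect, neg_neg]
    exact neg_lt_neg h.lax_other

theorem isGlobalCurveFrom_reflect {u : State} {smax : ℝ} {S : ℝ → State}
    (h : ConsLaw.IsGlobalCurveFrom (region γ C) (reflect u) smax S) :
    ConsLaw.IsGlobalCurveFrom (region γ C) u smax (fun s => reflect (S s)) where
  pos := h.pos
  start := by rw [h.start, reflect_reflect]
  cont := reflect.continuous.comp_continuousOn h.cont
  smooth := reflect.toContinuousLinearEquiv.contDiff.comp_contDiffOn h.smooth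
  mem s hs := reflect_mem_region (h.mem s hs)
  exits K hK hKc := by
    have hsub : reflect '' K ⊆ region γ C := by
      rintro _ ⟨x, hx, rfl⟩
      exact reflect_mem_region (hK hx)
    filter_upwards [h.exits _ hsub (hKc.image reflect.continuous)] with s hs hmem
    exact hs ⟨_, hmem, reflect_reflect _⟩

theorem norm_sub_reflect (u x : State) : ‖u - reflect x‖ = ‖reflect u - x‖ := by
  rw [← reflect.norm_map (u - reflect x), map_sub, reflect_reflect]

theorem isStrengthParam_reflect {smax : State → ℝ} {S : State → ℝ → State}
    (h : ConsLaw.IsStrengthParam (region γ C) smax S) :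
    ConsLaw.IsStrengthParam (region γ C) (fun u => smax (reflect u))
      (fun u s => reflect (S (reflect u) s)) where
  small d hd := by
    obtain ⟨ε, hε, hs⟩ := h.small _ (reflect_mem_region hd)
    refine ⟨ε, hε, fun u hu s hs0 hsε => ?_⟩
    rw [norm_sub_reflect]
    refine hs _ ⟨reflect_mem_region hu.1, ?_⟩ s hs0 hsε
    rw [Metric.mem_ball, reflect.dist_map]
    exact hu.2
  whole u hu hder s hs := by
    simp only [norm_sub_reflect] at hder ⊢
    exact h.whole _ (reflect_mem_region hu) hder s hs

/-! ### The reparametrized 1-shock curves -/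

theorem isGlobalCurveFrom_shockCurve (hγ : 1 < γ) {u : State} {T smax : ℝ} {Q : ℝ → ℝ}
    (hu : 0 < u 0) (hin : ∀ t ∈ Ico 0 T, shockCurve γ u t ∈ region γ C)
    (hout : ∀ t, T ≤ t → shockCurve γ u t ∉ region γ C) (hQ : ConsLaw.IsReparam T smax Q) :
    ConsLaw.IsGlobalCurveFrom (region γ C) u smax (fun s => shockCurve γ u (Q s)) := by
  have hT : 0 < T := by
    by_contra! hle
    have h0 : (u : State) ∉ region γ C := by simpa [shockCurve_zero] using hout 0 hle
    have hm := hQ.mem (smax / 2) ⟨by linarith [hQ.pos], by linarith [hQ.pos]⟩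
    linarith [hm.1, hm.2]
  have hcase : ∀ s ∈ Icc 0 smax, 0 ≤ Q s := by
    intro s hs
    rcases hs.1.eq_or_lt with rfl | h0
    · rw [hQ.zero]
    rcases hs.2.eq_or_lt with rfl | h1
    · rw [hQ.right]
      exact hT.le
    · exact (hQ.mem s ⟨h0, h1⟩).1.le
  have hc : ContinuousOn (fun s => shockCurve γ u (Q s)) (Icc 0 smax) :=
    (continuousOn_shockCurve hγ hu).comp hQ.cont hcase
  refine ⟨hQ.pos, by simp only [hQ.zero, shockCurve_zero], hc.mono Ico_subset_Icc_self, ?_, ?_, ?_⟩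
  · intro s hs
    exact (contDiffAt_shockCurve hγ hu (hQ.mem s hs).1).comp_contDiffWithinAt s (hQ.smooth s hs)
  · intro s hs
    rcases hs.1.eq_or_lt with rfl | h0
    · exact hin _ (by rw [hQ.zero]; exact ⟨le_rfl, hT⟩)
    · exact hin _ (Ioo_subset_Ico_self (hQ.mem s ⟨h0, hs.2⟩))
  · intro K hK hKc
    -- The curve extends continuously to `smax` with an end point outside the region, hence in the
    -- open complement of `K`.
    have hlim := (hc smax ⟨hQ.pos.le, le_rfl⟩).mono Ico_subset_Icc_self
    rw [ContinuousWithinAt, nhdsWithin_Ico_eq_nhdsLT hQ.pos] at hlim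
    refine hlim.eventually_mem (hKc.isClosed.isOpen_compl.mem_nhds fun hmem => ?_)
    rw [hQ.right] at hmem
    exact hout T le_rfl (hK hmem)

end Euler

/-! ### Both families together -/

/-- The isentropic Euler system on its invariant region, with its physical entropy, satisfies
assumptions (a)-(k). -/
theorem lemma4p4 (γ C : ℝ) (hγ : 1 < γ) (hC : 0 < C) :
    ∃ (lam₁ lam₂ q : State → ℝ)
      (s₁ : State → ℝ) (S₁ : State → ℝ → State) (σ₁ : State → ℝ → ℝ)
      (s₂ : State → ℝ) (S₂ : State → ℝ → State) (σ₂ : State → ℝ → ℝ),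
      ConsLaw.Assumptions (Euler.stateSet γ C) (Euler.flux γ) lam₁ lam₂ (Euler.entropy γ) q
        s₁ S₁ σ₁ s₂ S₂ σ₂ := by
  open Euler in
  have hex : ∀ u : State, ∃ T : ℝ, u ∈ region γ C → 0 < T ∧
      (∀ t ∈ Ico 0 T, shockCurve γ u t ∈ region γ C) ∧
      ∀ t, T ≤ t → shockCurve γ u t ∉ region γ C := by
    intro u
    by_cases hu : u ∈ region γ C
    · obtain ⟨T, h⟩ := exists_exit hγ hC hu
      exact ⟨T, fun _ => h⟩
    · exact ⟨0, fun h => absurd h hu⟩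
  choose T hT using hex
  obtain ⟨smax, Q, hstr, hQ⟩ := ConsLaw.exists_strengthParam (V := region γ C) (T := T)
    (U := shockCurve γ) (fun u hu => (hT u hu).1) (fun u _ => shockCurve_zero γ u)
    (fun u hu => (continuousOn_shockCurve hγ hu.1).mono Icc_subset_Ici_self)
    (fun u hu t ht => (contDiffAt_shockCurve hγ hu.1 ht.1).contDiffWithinAt)
    (fun u _ t ht => le_norm_sub_shockCurve γ u ht.1.le)
    (fun d hd => by
      obtain ⟨ε, hε, h⟩ := strength_increasing_locally hγ hd.1
      exact ⟨ε, hε, fun u hu t ht htε => h u hu.2 hu.1.1 t ht.1 htε⟩)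
  have hcurve : ∀ u ∈ region γ C, ConsLaw.IsGlobalCurveFrom (region γ C) u (smax u)
      (fun s => shockCurve γ u (Q u s)) := fun u hu =>
    isGlobalCurveFrom_shockCurve hγ hu.1 (hT u hu).2.1 (hT u hu).2.2 (hQ u hu)
  have hshock : ∀ u ∈ region γ C, ∀ s ∈ Ioo 0 (smax u),
      ConsLaw.IsOneShock (flux γ) (entropy γ) (entropyFlux γ) (charSpeed γ (-1)) (charSpeed γ 1) u
        (shockCurve γ u (Q u s)) (shockSpeed γ u (Q u s)) := fun u hu s hs =>
    isOneShock_shockCurve hγ hu.1 ((hQ u hu).mem s hs).1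
  have hg : ∀ uL ∈ stateSet γ C, ∀ uR ∈ region γ C, ∀ σ : ℝ,
      ConsLaw.IsEntropicDisc (flux γ) (entropy γ) (entropyFlux γ) uL uR σ →
      charSpeed γ (-1) uR < σ := fun uL hL uR hR σ h =>
    charSpeed_lt_of_isEntropicDisc hγ (mem_region_left_of_isEntropicDisc hγ hC hL hR h).1 hR.1 h
  have hh : ∀ uL ∈ region γ C, ∀ uR ∈ stateSet γ C, ∀ σ : ℝ,
      ConsLaw.IsEntropicDisc (flux γ) (entropy γ) (entropyFlux γ) uL uR σ →
      σ ≤ charSpeed γ (-1) uL →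
      ∃ s ∈ Ico 0 (smax uL), shockCurve γ uL (Q uL s) = uR ∧ σ = shockSpeed γ uL (Q uL s) := by
    intro uL hL uR hR σ h hσ
    have hR' := mem_region_right_of_isEntropicDisc hγ hC hL hR h
    obtain ⟨t, ht, rfl, rfl⟩ := eq_shockCurve_of_isEntropicDisc hγ hL.1 hR'.1 h hσ
    -- Here it matters that the curve never re-enters the region after `T uL`.
    have htT : t < T uL := by
      by_contra! hle
      exact (hT uL hL).2.2 t hle hR'
    obtain ⟨s, hs, rfl⟩ := (hQ uL hL).surj t ⟨ht, htT⟩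
    exact ⟨s, Ioo_subset_Ico_self hs, rfl, rfl⟩
  have hk : ∀ u ∈ region γ C, ∀ s ∈ Ioo 0 (smax u),
      0 < deriv (fun t => ConsLaw.relEntropy (entropy γ) u (shockCurve γ u (Q u t))) s := by
    intro u hu s hs
    obtain ⟨c, hc, hcd⟩ := (hQ u hu).deriv_pos s hs
    obtain ⟨e, he, hed⟩ := hasDerivAt_relEntropy_shockCurve hγ hu.1 ((hQ u hu).mem s hs).1
    have h : HasDerivAt (fun t => ConsLaw.relEntropy (entropy γ) u (shockCurve γ u (Q u t)))
        (e * c) s := hed.comp s hcd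
    rw [h.deriv]
    positivity
  have hkσ : ∀ u ∈ region γ C, ∀ s ∈ Ioo 0 (smax u),
      deriv (fun t => shockSpeed γ u (Q u t)) s < 0 := by
    intro u hu s hs
    obtain ⟨c, hc, hcd⟩ := (hQ u hu).deriv_pos s hs
    obtain ⟨e, he, hed⟩ := hasDerivAt_shockSpeed_neg hγ hu.1 ((hQ u hu).mem s hs).1
    have h : HasDerivAt (fun t => shockSpeed γ u (Q u t)) (e * c) s := hed.comp s hcd
    rw [h.deriv]
    exact mul_neg_of_neg_of_pos he hc
  have hint := interior_stateSet hγ hC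
  refine ⟨charSpeed γ (-1), charSpeed γ 1, entropyFlux γ,
    smax, fun u s => shockCurve γ u (Q u s), fun u s => shockSpeed γ u (Q u s),
    fun u => smax (reflect u), fun u s => reflect (shockCurve γ (reflect u) (Q (reflect u) s)),
    fun u s => -shockSpeed γ (reflect u) (Q (reflect u) s), ?_⟩
  constructor <;> try rw [hint]
  · exact isBounded_stateSet hγ hC
  · exact continuousOn_flux hγ hC
  · exact fun u hu => (contDiffAt_flux γ hu.1).contDiffWithinAt
  · exact fun u hu => hasEigenvalue_flux hγ (by norm_num) hu.1
  · exact fun u hu => hasEigenvalue_flux hγ (by norm_num) hu.1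
  · intro u hu
    have := soundSpeed_pos hγ hu.1
    simp only [charSpeed]
    linarith
  · exact fun u hu r hr => genuinely_nonlinear hγ (by norm_num) hu.1 hr
  · exact fun u hu r hr => genuinely_nonlinear hγ (by norm_num) hu.1 hr
  · exact strictConvexOn_entropy hγ hC
  · exact fun u hu w hw => posDef_entropy hγ hu.1 hw
  · exact continuousOn_entropy hγ hC
  · exact fun u hu => (contDiffAt_entropy γ hu.1).contDiffWithinAt
  · exact continuousOn_entropyFlux hγ hC
  · exact fun u hu => (contDiffAt_entropyFlux γ hu.1).contDiffWithinAt
  · exact fun u hu => entropyFlux_compat hγ hu.1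
  · exact fun _ _ ℓ _ => convexOn_or_concaveOn_comp_flux hγ ℓ
  · exact exists_charSpeed_bound hγ hC
  · exact hcurve
  · exact hshock
  · exact hstr
  · exact fun u hu => isGlobalCurveFrom_reflect (hcurve _ (reflect_mem_region hu))
  · intro u hu s hs
    have := isTwoShock_reflect (hshock _ (reflect_mem_region hu) s hs)
    rwa [reflect_reflect] at this
  · exact isStrengthParam_reflect hstr
  · exact hg
  · exact hh
  -- Conditions (i) and (j) are (g) and (h) for the reflected jump, with left and right exchanged.
  · intro uL hL uR hR σ h
    have := hg _ (reflect_mem_stateSet hγ hC hR) _ (reflect_mem_region hL) _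
      (isEntropicDisc_reflect h)
    rw [charSpeed_reflect, neg_neg] at this
    exact neg_lt_neg_iff.1 this
  · intro uL hL uR hR σ h hσ
    obtain ⟨s, hs, h1, h2⟩ := hh _ (reflect_mem_region hR) _ (reflect_mem_stateSet hγ hC hL) _
      (isEntropicDisc_reflect h) (by rw [charSpeed_reflect, neg_neg]; exact neg_le_neg hσ)
    exact ⟨s, hs, by rw [h1, reflect_reflect], by rw [← h2, neg_neg]⟩
  · exact hk
  · intro u hu s hs
    have h := hk _ (reflect_mem_region hu) s hs
    have e : ∀ t, ConsLaw.relEntropy (entropy γ) u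
        (reflect (shockCurve γ (reflect u) (Q (reflect u) t))) =
        ConsLaw.relEntropy (entropy γ) (reflect u)
          (shockCurve γ (reflect u) (Q (reflect u) t)) := fun t => by
      rw [← relEntropy_reflect, reflect_reflect]
    simpa only [e] using h
  · exact hkσ
  · intro u hu s hs
    rw [deriv.fun_neg]
    exact neg_pos.2 (hkσ _ (reflect_mem_region hu) s hs)
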